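/- Let $1\le L<M$, let $Q$ be a real positive semidefinite $M\times M$ matrix of rank $L$ and let $P_0$ be a real positive semidefinite $M\times M$ matrix. Consider $M$ correlated sources with state $x_{t+1}=x_t+w_t\in\mathbb R^M$, $t\ge 0$, where the increments $w_t\sim\mathcal N(0,Q)$ are i.i.d. and independent of $x_0\sim\mathcal N(m_0,P_0)$ (the initial estimate $m_0$ and its error covariance $P_0$ are known). In each slot $t$ a monitor reads one sensor $\pi(t)\in\{1,\dots,M\}$ and receives $y_t=x_t^{\pi(t)}$. A scheduling policy is oblivious and causal if $\pi(t)$ is a function only of $\pi(0),\dots,\pi(t-1)$, of $y_0,\dots,y_{t-1}$ and of a randomization independent of the process; an estimator $\hat x_t$ of $x_t$ is a function of the decisions and samples up to and including slot $t$ and of that randomization. Let $$P_{\mathrm{OPT}}=\inf\ \limsup_{T\to\infty}\frac1T\sum_{t=1}^T\mathbb E\,\|x_t-\hat x_t\|_2^2,$$ where the infimum is over all oblivious causal scheduling policies and all estimators. Let $Q'=(q'_{ij})$ be any principal $L\times L$ submatrix of $Q$ of rank $L$, and let $\lambda_L(Q')$ be its $L$-th largest (that is, smallest) eigenvalue. Then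 $$\frac{L(L+1)}{2}\,\lambda_L(Q')-\operatorname{tr}(Q)\ \le\ P_{\mathrm{OPT}}\ \le\ c\left(\Big(\sum_{i=1}^L\sqrt{q'_{ii}}\Big)^2-\sum_{i=1}^L q'_{ii}\right)$$ for a constant $c>0$ that depends only on $M$, $L$ and on the $M\times L$ matrix $H$ of the coefficients expressing the increments of all sources through those of the $L$ sources of $Q'$ (that is, $w_t=Hw'_t$ almost surely, where $w'_t$ is the vector of the increments of these $L$ sources). -/

import Mathlib

open MeasureTheory ProbabilityTheory Filter

noncomputable section

namespace Monitoring

/-- The state at time `t` of the random walk `x_{t+1} = x_t + w_t` started at `x₀`. -/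
def state {Ω : Type*} {M : ℕ} (x₀ : Ω → EuclideanSpace ℝ (Fin M))
    (w : ℕ → Ω → EuclideanSpace ℝ (Fin M)) (t : ℕ) (ω : Ω) : EuclideanSpace ℝ (Fin M) :=
  x₀ ω + ∑ s ∈ Finset.range t, w s ω

/-- The correlated random walk with Gaussian increments. The initial state `x₀` is normal with mean
`m₀` (the initial estimate) and covariance `P₀` (the initial error covariance), the increments are
i.i.d. `N(0, Q)` and independent of `x₀`, and `U` is a source of randomness, independent of the
whole process, on which a randomized scheduler may draw. -/
structure IsGaussianWalk {Ω R : Type*} [MeasurableSpace Ω] [MeasurableSpace R] {M : ℕ}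
    (μ : Measure Ω) (m₀ : EuclideanSpace ℝ (Fin M)) (P₀ Q : Matrix (Fin M) (Fin M) ℝ)
    (U : Ω → R) (x₀ : Ω → EuclideanSpace ℝ (Fin M))
    (w : ℕ → Ω → EuclideanSpace ℝ (Fin M)) : Prop where
  measurable_rand : Measurable U
  measurable_init : Measurable x₀
  measurable_incr : ∀ t, Measurable (w t)
  law_init : HasLaw x₀ (multivariateGaussian m₀ P₀) μ
  law_incr : ∀ t, HasLaw (w t) (multivariateGaussian 0 Q) μ
  indep_incr : iIndepFun w μ
  indep_init : IndepFun x₀ (fun ω t => w t ω) μ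
  indep_rand : IndepFun U (fun ω => (x₀ ω, fun t => w t ω)) μ

/-- What the monitor knows before it takes the decision of slot `t` under the schedule `c`: the
randomization, the earlier decisions `c s`, and the samples `y_s = (x_s)_{c s}` received for
`s < t`. -/
@[reducible] def info {Ω R : Type*} [MeasurableSpace R] {M : ℕ} (U : Ω → R)
    (x₀ : Ω → EuclideanSpace ℝ (Fin M)) (w : ℕ → Ω → EuclideanSpace ℝ (Fin M))
    (c : ℕ → Ω → Fin M) (t : ℕ) : MeasurableSpace Ω :=
  MeasurableSpace.comap U inferInstance ⊔
    ⨆ s : Fin t, MeasurableSpace.comap (fun ω => (c s ω, state x₀ w s ω (c s ω))) inferInstance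

/-- `c` is the sequence of sensors scheduled by a causal oblivious (possibly randomized) policy:
exactly one sensor is read in each slot, and the decision of slot `t` is a function of the earlier
decisions, the earlier samples and the randomization. -/
def IsObliviousSchedule {Ω R : Type*} [MeasurableSpace R] {M : ℕ} (U : Ω → R)
    (x₀ : Ω → EuclideanSpace ℝ (Fin M)) (w : ℕ → Ω → EuclideanSpace ℝ (Fin M))
    (c : ℕ → Ω → Fin M) : Prop :=
  ∀ t, Measurable[info U x₀ w c t] (c t)

/-- `xhat` is a sequence of estimators of the state under the schedule `c`: the estimate at time `t`
is a function of everything received up to and including slot `t`. -/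
def IsEstimator {Ω R : Type*} [MeasurableSpace R] {M : ℕ} (U : Ω → R)
    (x₀ : Ω → EuclideanSpace ℝ (Fin M)) (w : ℕ → Ω → EuclideanSpace ℝ (Fin M))
    (c : ℕ → Ω → Fin M) (xhat : ℕ → Ω → EuclideanSpace ℝ (Fin M)) : Prop :=
  ∀ t, Measurable[info U x₀ w c (t + 1)] (xhat t)

/-- The long-run time average `limsup_T (1/T) ∑_{t=1}^T E‖x_t - xhat_t‖²`. -/
def averageError {Ω : Type*} [MeasurableSpace Ω] {M : ℕ} (μ : Measure Ω)
    (x₀ : Ω → EuclideanSpace ℝ (Fin M)) (w xhat : ℕ → Ω → EuclideanSpace ℝ (Fin M)) : ENNReal :=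
  limsup (fun T : ℕ =>
    (∑ t ∈ Finset.Icc 1 T, ∫⁻ ω, ‖state x₀ w t ω - xhat t ω‖ₑ ^ 2 ∂μ) / (T : ENNReal)) atTop

/-- The optimal monitoring error `P_OPT`: the least long-run average error over all oblivious
scheduling policies and all estimators. -/
def optimalError {Ω R : Type*} [MeasurableSpace Ω] [MeasurableSpace R] {M : ℕ} (μ : Measure Ω)
    (U : Ω → R) (x₀ : Ω → EuclideanSpace ℝ (Fin M))
    (w : ℕ → Ω → EuclideanSpace ℝ (Fin M)) : ENNReal :=
  ⨅ (c : ℕ → Ω → Fin M) (_ : IsObliviousSchedule U x₀ w c)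
    (xhat : ℕ → Ω → EuclideanSpace ℝ (Fin M)) (_ : IsEstimator U x₀ w c xhat),
    averageError μ x₀ w xhat

/-- The `k`-th largest eigenvalue (`1 ≤ k ≤ n`) of a real symmetric `n × n` matrix. -/
def eigenvalue {n : ℕ} {A : Matrix (Fin n) (Fin n) ℝ} (hA : A.IsHermitian) (k : ℕ)
    (hk : 1 ≤ k ∧ k ≤ n) : ℝ :=
  hA.eigenvalues₀ ⟨k - 1, by rw [Fintype.card_fin]; omega⟩

/-- The `M × L` matrix `H` of the coefficients that express the increments of all the sources
through those of the selected sources `S`, i.e. `w = H (w_{S 1}, …, w_{S L})` almost surely, when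
the covariance `Q` and its submatrix on `S` have the same rank `L`. -/
def coefficients {M L : ℕ} (Q : Matrix (Fin M) (Fin M) ℝ) (S : Fin L ↪ Fin M) :
    Matrix (Fin M) (Fin L) ℝ :=
  Q.submatrix id S * (Q.submatrix S S)⁻¹

end Monitoring

end

noncomputable section

namespace Monitoring

/-! Write `w = H w'` with `H = coefficients Q S`, and let `h_j` be the rows of `H`: sensor `j` sees
the `L`-dimensional noise only through `h_j`.

Lower bound. On the event that the decisions follow a fixed path `d`, the monitor knows no more than
under the deterministic schedule `d` (`measurableSet_info_inter`), so paths can be treated one by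
one. Gram–Schmidt applied to the rows read in slots `t, t - 1, …` gives an orthonormal basis whose
vector `b_k`, `k = 0, …, L - 1`, is orthogonal to the `k` latest rows. Reveal the randomization, the
initial state, all increments before slot `t - k` and, of the increments from then on, every
coordinate read in the last `k` reads. In the direction `b_k` there remain `k` independent
innovations, each of variance at least `λ_L(Q')` (`exists_innovation`), and no estimator removes
them (`variance_mul_measure_le_lintegral`). Summing over `k` gives `L (L - 1) / 2 * λ_L(Q')`, and `L
* λ_L(Q') ≤ tr Q` turns this into the claim.

Upper bound. Almost surely each source is a fixed combination of the selected ones plus an offset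
constant in time (`ae_state_eq`). A finite training phase of `N` blocks estimates the offsets with
error `O(1/N)` and is invisible in the long-run average. Afterwards only the selected sources are
read and held. The most volatile one, `i₀`, is read by default; source `i` takes one slot in `L * K
i`, with `K i` about `√(q i₀ / q i)`. Holding `i` then costs about `L √(q i q i₀)`, while the slots
taken from `i₀` cost it at most `√(q i₀ q i)` on average. Both are cross terms of `(∑ √q)² - ∑ q`
(`sum_mul_rate_le`). Finally `N → ∞`. -/

/-- The linear form `∑_{r < N} ⟪u r, w r⟫` in the increments. -/
def incrForm {Ω : Type*} {M : ℕ} (w : ℕ → Ω → EuclideanSpace ℝ (Fin M)) (N : ℕ)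
    (u : ℕ → EuclideanSpace ℝ (Fin M)) (ω : Ω) : ℝ :=
  ∑ r ∈ Finset.range N, inner ℝ (u r) (w r ω)

/-- The bilinear form of a matrix on Euclidean space. -/
def bilin {M : ℕ} (Q : Matrix (Fin M) (Fin M) ℝ) (u v : EuclideanSpace ℝ (Fin M)) : ℝ :=
  u.ofLp ⬝ᵥ Q.mulVec v.ofLp

/-- If `A` is independent of `B` and `(A, B)` of `C`, then `A` is independent of `(B, C)`. -/
theorem indepFun_prodMk_of_indepFun {Ω α β γ : Type*} [MeasurableSpace Ω] [MeasurableSpace α]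
    [MeasurableSpace β] [MeasurableSpace γ] {μ : Measure Ω} [IsProbabilityMeasure μ]
    {A : Ω → α} {B : Ω → β} {C : Ω → γ} (hA : Measurable A) (hB : Measurable B)
    (hC : Measurable C) (hAB : IndepFun A B μ) (hABC : IndepFun (fun ω => (A ω, B ω)) C μ) :
    IndepFun A (fun ω => (B ω, C ω)) μ := by
  have hBC : IndepFun B C μ := hABC.comp (φ := Prod.snd) (ψ := id) measurable_snd measurable_id
  have := Measure.isProbabilityMeasure_map (μ := μ) hA.aemeasurable
  have := Measure.isProbabilityMeasure_map (μ := μ) hB.aemeasurable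
  have := Measure.isProbabilityMeasure_map (μ := μ) hC.aemeasurable
  rw [indepFun_iff_map_prod_eq_prod_map_map hA.aemeasurable (hB.prodMk hC).aemeasurable]
  rw [indepFun_iff_map_prod_eq_prod_map_map hA.aemeasurable hB.aemeasurable] at hAB
  rw [indepFun_iff_map_prod_eq_prod_map_map (hA.prodMk hB).aemeasurable hC.aemeasurable] at hABC
  rw [indepFun_iff_map_prod_eq_prod_map_map hB.aemeasurable hC.aemeasurable] at hBC
  rw [hBC, ← (measurePreserving_prodAssoc _ _ _).map_eq, ← hAB, ← hABC, Measure.map_map (by fun_prop) (by fun_prop)]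
  rfl

/-! ### Second moments and independence of linear forms in the Gaussian increments. -/

section walk

variable {Ω R : Type*} [MeasurableSpace Ω] [MeasurableSpace R] {M : ℕ} {μ : Measure Ω}
  {m₀ : EuclideanSpace ℝ (Fin M)} {P₀ Q : Matrix (Fin M) (Fin M) ℝ} {U : Ω → R}
  {x₀ : Ω → EuclideanSpace ℝ (Fin M)} {w : ℕ → Ω → EuclideanSpace ℝ (Fin M)}

theorem IsGaussianWalk.measurable_incrForm (hw : IsGaussianWalk μ m₀ P₀ Q U x₀ w) (N : ℕ)
    (u : ℕ → EuclideanSpace ℝ (Fin M)) : Measurable (incrForm w N u) := by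
  have := hw.measurable_incr
  unfold incrForm
  fun_prop

theorem IsGaussianWalk.measurable_state (hw : IsGaussianWalk μ m₀ P₀ Q U x₀ w) (t : ℕ) :
    Measurable (state x₀ w t) := by
  have := hw.measurable_incr
  have := hw.measurable_init
  unfold state
  fun_prop

theorem IsGaussianWalk.memLp_inner (hw : IsGaussianWalk μ m₀ P₀ Q U x₀ w) (r : ℕ)
    (u : EuclideanSpace ℝ (Fin M)) : MemLp (fun ω => inner ℝ u (w r ω)) 2 μ :=
  ((hw.law_incr r).hasGaussianLaw.map_fun (innerSL ℝ u)).memLp_two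

theorem IsGaussianWalk.integral_inner (hw : IsGaussianWalk μ m₀ P₀ Q U x₀ w) (r : ℕ)
    (u : EuclideanSpace ℝ (Fin M)) : ∫ ω, inner ℝ u (w r ω) ∂μ = 0 := by
  have h : ∫ ω, w r ω ∂μ = 0 := by
    rw [(hw.law_incr r).integral_eq, integral_id_multivariateGaussian]
  rw [_root_.integral_inner (hw.law_incr r).hasGaussianLaw.integrable, h, inner_zero_right]

theorem IsGaussianWalk.covariance_inner [IsProbabilityMeasure μ]
    (hw : IsGaussianWalk μ m₀ P₀ Q U x₀ w) (hQ : Q.PosSemidef)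
    (r q : ℕ) (u v : EuclideanSpace ℝ (Fin M)) :
    cov[fun ω => inner ℝ u (w r ω), fun ω => inner ℝ v (w q ω); μ]
      = if r = q then bilin Q u v else 0 := by
  split_ifs with h
  · subst h
    rw [(hw.law_incr r).covariance_fun_comp (f := fun x => inner ℝ u x)
      (g := fun x => inner ℝ v x) (by fun_prop) (by fun_prop),
      ← covarianceBilin_apply_eq_cov IsGaussian.memLp_two_id,
      covarianceBilin_multivariateGaussian hQ]
    rfl
  · exact ((hw.indep_incr.indepFun h).comp (φ := fun x => inner ℝ u x)
      (ψ := fun x => inner ℝ v x) (by fun_prop) (by fun_prop)).covariance_eq_zero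
      (hw.memLp_inner r u) (hw.memLp_inner q v)

theorem IsGaussianWalk.memLp_incrForm (hw : IsGaussianWalk μ m₀ P₀ Q U x₀ w) (N : ℕ)
    (u : ℕ → EuclideanSpace ℝ (Fin M)) : MemLp (incrForm w N u) 2 μ :=
  memLp_finsetSum _ fun r _ => hw.memLp_inner r (u r)

theorem IsGaussianWalk.integral_incrForm [IsProbabilityMeasure μ]
    (hw : IsGaussianWalk μ m₀ P₀ Q U x₀ w) (N : ℕ)
    (u : ℕ → EuclideanSpace ℝ (Fin M)) : ∫ ω, incrForm w N u ω ∂μ = 0 := by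
  unfold incrForm
  rw [integral_finsetSum _ fun r _ => (hw.memLp_inner r (u r)).integrable (by norm_num)]
  exact Finset.sum_eq_zero fun r _ => hw.integral_inner r _

theorem IsGaussianWalk.covariance_incrForm [IsProbabilityMeasure μ]
    (hw : IsGaussianWalk μ m₀ P₀ Q U x₀ w) (hQ : Q.PosSemidef) (N : ℕ)
    (u v : ℕ → EuclideanSpace ℝ (Fin M)) :
    cov[incrForm w N u, incrForm w N v; μ] = ∑ r ∈ Finset.range N, bilin Q (u r) (v r) := by
  unfold incrForm
  rw [covariance_fun_sum_fun_sum' (fun r _ => hw.memLp_inner r (u r))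
    (fun r _ => hw.memLp_inner r (v r))]
  refine Finset.sum_congr rfl fun r hr => ?_
  simp_rw [hw.covariance_inner hQ]
  rw [Finset.sum_ite_eq, if_pos hr]

theorem IsGaussianWalk.integral_incrForm_sq [IsProbabilityMeasure μ]
    (hw : IsGaussianWalk μ m₀ P₀ Q U x₀ w) (hQ : Q.PosSemidef) (N : ℕ)
    (u : ℕ → EuclideanSpace ℝ (Fin M)) :
    ∫ ω, incrForm w N u ω ^ 2 ∂μ = ∑ r ∈ Finset.range N, bilin Q (u r) (u r) := by
  rw [← hw.covariance_incrForm hQ, covariance_self (hw.measurable_incrForm N u).aemeasurable,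
    variance_of_integral_eq_zero (hw.measurable_incrForm N u).aemeasurable
      (hw.integral_incrForm N u)]

/-- All these forms are linear images of one Gaussian vector, so vanishing covariances already give
joint independence from the whole family. -/
theorem IsGaussianWalk.indepFun_incrForm [IsProbabilityMeasure μ]
    (hw : IsGaussianWalk μ m₀ P₀ Q U x₀ w) (hQ : Q.PosSemidef) {κ : Type*} [Fintype κ] (N : ℕ)
    (v : ℕ → EuclideanSpace ℝ (Fin M)) (y : κ → ℕ → EuclideanSpace ℝ (Fin M))
    (h : ∀ k, ∑ r ∈ Finset.range N, bilin Q (v r) (y k r) = 0) :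
    IndepFun (incrForm w N v) (fun ω k => incrForm w N (y k) ω) μ := by
  have hG : HasGaussianLaw (fun ω (r : Fin N) => w r ω) μ :=
    iIndepFun.hasGaussianLaw (fun r => (hw.law_incr r).hasGaussianLaw)
      (hw.indep_incr.precomp Fin.val_injective)
  let F : (ℕ → EuclideanSpace ℝ (Fin M)) → (Fin N → EuclideanSpace ℝ (Fin M)) →L[ℝ] ℝ :=
    fun u => ∑ r : Fin N, (innerSL ℝ (u r)).comp (ContinuousLinearMap.proj r)
  have hF : ∀ u ω, F u (fun r => w r ω) = incrForm w N u ω := by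
    intro u ω
    simp [F, incrForm, Finset.sum_range]
  -- The single form is packed as a family over `Unit` to match the criterion for two families.
  have hJ : HasGaussianLaw (fun ω => (fun _ : Unit => incrForm w N v ω,
      fun k => incrForm w N (y k) ω)) μ := by
    have := hG.map_fun ((ContinuousLinearMap.pi fun _ : Unit => F v).prod
      (ContinuousLinearMap.pi fun k => F (y k)))
    simpa [hF] using this
  have := hJ.indepFun_of_covariance_eval (X := fun _ : Unit => incrForm w N v)
    (Y := fun k => incrForm w N (y k)) fun _ k => by rw [hw.covariance_incrForm hQ, h]
  exact this.comp (φ := fun f : Unit → ℝ => f ()) (ψ := id) (measurable_pi_apply ()) measurable_id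

/-- A linear form in the increments which is uncorrelated with finitely many others is independent
of these, the initial state and the randomization together. -/
theorem IsGaussianWalk.indepFun_incrForm_init_rand [IsProbabilityMeasure μ]
    (hw : IsGaussianWalk μ m₀ P₀ Q U x₀ w) (hQ : Q.PosSemidef) {κ : Type*} [Fintype κ] (N : ℕ)
    (v : ℕ → EuclideanSpace ℝ (Fin M)) (y : κ → ℕ → EuclideanSpace ℝ (Fin M))
    (h : ∀ k, ∑ r ∈ Finset.range N, bilin Q (v r) (y k r) = 0) :
    IndepFun (incrForm w N v) (fun ω => (((fun k => incrForm w N (y k) ω), x₀ ω), U ω)) μ := by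
  have hv := hw.measurable_incrForm N v
  have hy : Measurable fun ω k => incrForm w N (y k) ω :=
    measurable_pi_iff.2 fun k => hw.measurable_incrForm N (y k)
  have hform : ∀ u : ℕ → EuclideanSpace ℝ (Fin M), Measurable fun f : ℕ → EuclideanSpace ℝ (Fin M) =>
      ∑ r ∈ Finset.range N, inner ℝ (u r) (f r) := fun u => by fun_prop
  have hJ : Measurable fun f : ℕ → EuclideanSpace ℝ (Fin M) =>
      (∑ r ∈ Finset.range N, inner ℝ (v r) (f r : EuclideanSpace ℝ (Fin M)),
        fun k => ∑ r ∈ Finset.range N, inner ℝ (y k r) (f r : EuclideanSpace ℝ (Fin M))) :=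
    (hform v).prodMk (measurable_pi_iff.2 fun k => hform (y k))
  have hA : IndepFun (fun ω => (incrForm w N v ω, fun k => incrForm w N (y k) ω)) x₀ μ :=
    (hw.indep_init.comp measurable_id hJ).symm
  have hB : IndepFun (fun ω => (incrForm w N v ω, ((fun k => incrForm w N (y k) ω), x₀ ω))) U μ :=
    (hw.indep_rand.comp measurable_id
      (ψ := fun p : EuclideanSpace ℝ (Fin M) × (ℕ → EuclideanSpace ℝ (Fin M)) =>
        (∑ r ∈ Finset.range N, inner ℝ (v r) (p.2 r),
          ((fun k => ∑ r ∈ Finset.range N, inner ℝ (y k r) (p.2 r)), p.1)))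
      (((hform v).comp measurable_snd).prodMk
        ((measurable_pi_iff.2 fun k => (hform (y k)).comp measurable_snd).prodMk
          measurable_fst))).symm
  exact indepFun_prodMk_of_indepFun hv (hy.prodMk hw.measurable_init) hw.measurable_rand
    (indepFun_prodMk_of_indepFun hv hy hw.measurable_init (hw.indepFun_incrForm hQ N v y h) hA) hB

end walk

/-! ### Factorization of `Q` through the selected sources, and regression in a semidefinite form. -/

section linearAlgebra

open Matrix

theorem isUnit_of_rank_eq {L : ℕ} {A : Matrix (Fin L) (Fin L) ℝ} (h : A.rank = L) : IsUnit A := by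
  rw [← linearIndependent_rows_iff_isUnit, linearIndependent_iff_card_eq_finrank_span,
    Fintype.card_fin, Set.finrank, ← rank_eq_finrank_span_row, h]

theorem posDef_of_rank_eq {L : ℕ} {A : Matrix (Fin L) (Fin L) ℝ} (hA : A.PosSemidef)
    (h : A.rank = L) : A.PosDef :=
  hA.posDef_iff_isUnit.2 (isUnit_of_rank_eq h)

/-- The rows of `Q` are combinations, with coefficients `H`, of the selected ones. -/
theorem coefficients_mul {M L : ℕ} {Q : Matrix (Fin M) (Fin M) ℝ} {S : Fin L ↪ Fin M}
    (hQL : Q.rank = L) (hS : (Q.submatrix S S).rank = L) :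
    coefficients Q S * Q.submatrix S id = Q := by
  have hu := isUnit_of_rank_eq hS
  have hli : LinearIndependent ℝ (Q.submatrix S S).row := linearIndependent_rows_iff_isUnit.2 hu
  -- Independence survives from the truncated rows to the full ones; there are `L = rank Q` of them,
  -- so they span the row space.
  have hli' : LinearIndependent ℝ fun i => Q.row (S i) := by
    refine LinearIndependent.of_comp (LinearMap.funLeft ℝ ℝ S) ?_
    exact hli
  have hspan : Submodule.span ℝ (Set.range fun i => Q.row (S i))
      = Submodule.span ℝ (Set.range Q.row) := by
    refine Submodule.eq_of_le_of_finrank_eq (Submodule.span_mono ?_) ?_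
    · rintro _ ⟨i, rfl⟩
      exact ⟨S i, rfl⟩
    · rw [← rank_eq_finrank_span_row, hQL, finrank_span_eq_card hli', Fintype.card_fin]
  have hrow : ∀ j, ∃ a : Fin L → ℝ, ∑ i, a i • Q.row (S i) = Q.row j := fun j =>
    (Submodule.mem_span_range_iff_exists_fun ℝ).1
      (hspan ▸ Submodule.subset_span ⟨j, rfl⟩)
  choose a ha using hrow
  have h1 : (of a) * Q.submatrix S id = Q := by
    ext j k
    have := congrFun (ha j) k
    simpa [mul_apply] using this
  have h2 : (of a) * Q.submatrix S S = Q.submatrix id S := by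
    ext j k
    have := congrFun (congrFun h1 j) (S k)
    simpa [mul_apply] using this
  have h3 : coefficients Q S = of a := by
    rw [coefficients, ← h2, Matrix.mul_assoc, mul_nonsing_inv _ ((isUnit_iff_isUnit_det _).1 hu),
      Matrix.mul_one]
  rw [h3, h1]

theorem coefficients_mul_mul_transpose {M L : ℕ} {Q : Matrix (Fin M) (Fin M) ℝ}
    {S : Fin L ↪ Fin M} (hQ : Q.PosSemidef)
    (hQL : Q.rank = L) (hS : (Q.submatrix S S).rank = L) :
    coefficients Q S * Q.submatrix S S * (coefficients Q S)ᵀ = Q := by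
  have h1 := coefficients_mul hQL hS
  have hQt : Qᵀ = Q := hQ.isHermitian
  have h2 : Q.submatrix S S * (coefficients Q S)ᵀ = Q.submatrix S id := by
    have : (coefficients Q S * Q.submatrix S S)ᵀ = Q.submatrix S id := by
      have : coefficients Q S * Q.submatrix S S = Q.submatrix id S := by
        conv_rhs => rw [← h1]
        ext j k
        simp [mul_apply]
      rw [this, transpose_submatrix, hQt]
    rw [← this, transpose_mul, transpose_submatrix, hQt]
  rw [Matrix.mul_assoc, h2, h1]

/-- Variances in all `M` coordinates become values of the nonsingular form `Q'` at a vector of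
length `L`, where `λ_L(Q')` is a useful bound. -/
theorem bilin_eq_submatrix {M L : ℕ} {Q : Matrix (Fin M) (Fin M) ℝ}
    {S : Fin L ↪ Fin M} (hQ : Q.PosSemidef)
    (hQL : Q.rank = L) (hS : (Q.submatrix S S).rank = L) (v : EuclideanSpace ℝ (Fin M)) :
    bilin Q v v = (v.ofLp ᵥ* coefficients Q S) ⬝ᵥ
      (Q.submatrix S S *ᵥ (v.ofLp ᵥ* coefficients Q S)) := by
  conv_lhs => rw [bilin, ← coefficients_mul_mul_transpose hQ hQL hS]
  rw [← mulVec_mulVec, ← mulVec_mulVec, dotProduct_mulVec, mulVec_transpose]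

/-- The smallest eigenvalue bounds the quadratic form from below. -/
theorem eigenvalue_mul_le {L : ℕ} (hL : 1 ≤ L) {A : Matrix (Fin L) (Fin L) ℝ}
    (hA : A.IsHermitian) (x : Fin L → ℝ) :
    eigenvalue hA L ⟨hL, le_refl L⟩ * (x ⬝ᵥ x) ≤ x ⬝ᵥ A *ᵥ x := by
  let b := hA.eigenvectorBasis
  let X : EuclideanSpace ℝ (Fin L) := WithLp.toLp 2 x
  have hmin : ∀ j, eigenvalue hA L ⟨hL, le_refl L⟩ ≤ hA.eigenvalues j := by
    intro j
    refine hA.eigenvalues₀_antitone ?_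
    rw [Fin.le_def]
    have := ((Fintype.equivOfCardEq (Fintype.card_fin (Fintype.card (Fin L)))).symm j).isLt
    have h2 : Fintype.card (Fin L) = L := Fintype.card_fin L
    simp only
    omega
  have h1 : x ⬝ᵥ x = ∑ j, inner ℝ (b j) X ^ 2 := by
    have := b.sum_sq_inner_right X
    rw [this, EuclideanSpace.real_norm_sq_eq]
    simp [X, dotProduct, sq]
  have h2 : x ⬝ᵥ A *ᵥ x = ∑ j, hA.eigenvalues j * inner ℝ (b j) X ^ 2 := by
    have h3 := b.sum_inner_mul_inner X (WithLp.toLp 2 (A *ᵥ x))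
    have h4 : inner ℝ X (WithLp.toLp 2 (A *ᵥ x)) = x ⬝ᵥ A *ᵥ x := by
      simp [EuclideanSpace.inner_eq_star_dotProduct, X, dotProduct_comm]
    rw [← h4, ← h3]
    refine Finset.sum_congr rfl fun j _ => ?_
    have h5 : inner ℝ (b j) (WithLp.toLp 2 (A *ᵥ x)) = hA.eigenvalues j * inner ℝ (b j) X := by
      have h6 := hA.mulVec_eigenvectorBasis j
      have hAt : Aᵀ = A := hA
      simp only [EuclideanSpace.inner_eq_star_dotProduct, star_trivial, X]
      rw [dotProduct_comm, dotProduct_mulVec, ← mulVec_transpose, hAt]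
      change (A *ᵥ ⇑(hA.eigenvectorBasis j)) ⬝ᵥ x = _
      rw [h6, smul_dotProduct, smul_eq_mul, dotProduct_comm]
    rw [h5, real_inner_comm]
    ring
  rw [h1, h2, Finset.mul_sum]
  exact Finset.sum_le_sum fun j _ => mul_le_mul_of_nonneg_right (hmin j) (sq_nonneg _)

theorem eigenvalue_le_diag {L : ℕ} (hL : 1 ≤ L) {A : Matrix (Fin L) (Fin L) ℝ}
    (hA : A.IsHermitian) (i : Fin L) : eigenvalue hA L ⟨hL, le_refl L⟩ ≤ A i i := by
  simpa using eigenvalue_mul_le hL hA (Pi.single i 1)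

theorem eigenvalue_nonneg {L : ℕ} (hL : 1 ≤ L) {A : Matrix (Fin L) (Fin L) ℝ}
    (hA : A.PosSemidef) : 0 ≤ eigenvalue hA.isHermitian L ⟨hL, le_refl L⟩ := by
  have h := hA.eigenvalues_nonneg
    (Fintype.equivOfCardEq (Fintype.card_fin _) ⟨L - 1, by rw [Fintype.card_fin]; omega⟩)
  simpa [IsHermitian.eigenvalues, eigenvalue] using h

open scoped MatrixOrder in
/-- Regression on the coordinates in `D` with respect to a positive semidefinite form. -/
theorem exists_sub_bilin_eq_zero {M : ℕ} {Q : Matrix (Fin M) (Fin M) ℝ} (hQ : Q.PosSemidef)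
    (D : Set (Fin M)) (u : EuclideanSpace ℝ (Fin M)) :
    ∃ v : EuclideanSpace ℝ (Fin M), (∀ j ∉ D, v j = u j) ∧
      ∀ z : EuclideanSpace ℝ (Fin M), (∀ j ∉ D, z j = 0) → bilin Q v z = 0 := by
  -- `Q` may be singular, so its form is not an inner product. The square root carries it to the
  -- Euclidean one, where orthogonal projections exist.
  let f := toEuclideanLin (CFC.sqrt Q)
  have hf : ∀ x y, inner ℝ (f x) (f y) = bilin Q x y := by
    intro x y
    have hs : (CFC.sqrt Q)ᵀ = CFC.sqrt Q := (CFC.sqrt_nonneg Q).isSelfAdjoint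
    have h2 := CFC.sqrt_mul_sqrt_self Q hQ.nonneg
    conv_rhs => rw [bilin, ← h2]
    simp only [f, EuclideanSpace.inner_eq_star_dotProduct, star_trivial, toLpLin_apply]
    rw [← mulVec_mulVec, dotProduct_mulVec x.ofLp, ← mulVec_transpose, hs, dotProduct_comm]
  let p : Submodule ℝ (EuclideanSpace ℝ (Fin M)) :=
    { carrier := {z | ∀ j ∉ D, z j = 0}
      add_mem' := fun ha hb j hj => by simp [ha j hj, hb j hj]
      zero_mem' := fun j _ => by simp
      smul_mem' := fun c z hz j hj => by simp [hz j hj] }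
  -- The projection of `f u` lies in the image of `p`, so it has a preimage `y` supported in `D`;
  -- the residual is `u - y`.
  obtain ⟨y, hy, hyf⟩ := (Submodule.mem_map).1 ((p.map f).starProjection_apply_mem (f u))
  refine ⟨u - y, fun j hj => by simp [hy j hj], fun z hz => ?_⟩
  rw [← hf, map_sub, hyf]
  exact Submodule.starProjection_inner_eq_zero _ _ (Submodule.mem_map_of_mem hz)

end linearAlgebra

/-! ### Prediction of a variable from independent data. -/

theorem lintegral_enorm_sq_eq {Ω : Type*} [MeasurableSpace Ω] {μ : Measure Ω} {f : Ω → ℝ}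
    (hf : MemLp f 2 μ) : ∫⁻ ω, ‖f ω‖ₑ ^ 2 ∂μ = ENNReal.ofReal (∫ ω, f ω ^ 2 ∂μ) := by
  rw [ofReal_integral_eq_lintegral_ofReal hf.integrable_sq (ae_of_all _ fun _ => sq_nonneg _)]
  refine lintegral_congr fun ω => ?_
  rw [Real.enorm_eq_ofReal_abs, ← ENNReal.ofReal_pow (abs_nonneg _), sq_abs]

/-- A centred variable independent of `Z` cannot be predicted, on events and by functions of `Z`,
with a mean square error below its variance. -/
theorem variance_mul_measure_le_lintegral {Ω 𝒵 : Type*} [MeasurableSpace Ω] [MeasurableSpace 𝒵]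
    {μ : Measure Ω} [IsProbabilityMeasure μ] {ξ g : Ω → ℝ} {Z : Ω → 𝒵} {A : Set Ω}
    (hξm : Measurable ξ) (hξ : MemLp ξ 2 μ) (hξ0 : ∫ ω, ξ ω ∂μ = 0) (hZ : Measurable Z)
    (hind : IndepFun ξ Z μ) (hA : MeasurableSet[MeasurableSpace.comap Z inferInstance] A)
    (hg : Measurable[MeasurableSpace.comap Z inferInstance] g) :
    ENNReal.ofReal (∫ ω, ξ ω ^ 2 ∂μ) * μ A ≤ ∫⁻ ω in A, ‖ξ ω + g ω‖ₑ ^ 2 ∂μ := by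
  obtain ⟨A', hA', rfl⟩ := hA
  obtain ⟨g', hg', rfl⟩ := hg.exists_eq_measurable_comp
  have := Measure.isProbabilityMeasure_map (μ := μ) hξm.aemeasurable
  have := Measure.isProbabilityMeasure_map (μ := μ) hZ.aemeasurable
  -- With the data frozen the predictor is a constant `c`, and a centred variable satisfies `E (ξ +
  -- c)² = E ξ² + c²`. Fubini then integrates over the data.
  have hinner : ∀ c : ℝ, ENNReal.ofReal (∫ ω, ξ ω ^ 2 ∂μ)
      ≤ ∫⁻ x, ‖x + c‖ₑ ^ 2 ∂(μ.map ξ) := by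
    intro c
    rw [lintegral_map (by fun_prop) hξm, lintegral_enorm_sq_eq (f := fun ω => ξ ω + c) (hξ.add (memLp_const c))]
    refine ENNReal.ofReal_le_ofReal ?_
    have h1 : Integrable ξ μ := hξ.integrable (by norm_num)
    have h2 : ∫ ω, (ξ ω + c) ^ 2 ∂μ = ∫ ω, ξ ω ^ 2 ∂μ + c ^ 2 := by
      have : ∀ ω, (ξ ω + c) ^ 2 = ξ ω ^ 2 + (2 * c) * ξ ω + c ^ 2 := fun ω => by ring
      simp_rw [this]
      have h3 : Integrable (fun ω => ξ ω ^ 2 + (2 * c) * ξ ω) μ :=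
        hξ.integrable_sq.add (h1.const_mul _)
      rw [integral_add h3 (integrable_const _),
        integral_add hξ.integrable_sq (h1.const_mul _), integral_const_mul, hξ0]
      simp
    rw [h2]
    nlinarith [sq_nonneg c]
  have hmap := (indepFun_iff_map_prod_eq_prod_map_map hZ.aemeasurable hξm.aemeasurable).1 hind.symm
  have hF : Measurable fun p : 𝒵 × ℝ => (A' ×ˢ Set.univ).indicator (fun p => ‖p.2 + g' p.1‖ₑ ^ 2) p :=
    Measurable.indicator (by fun_prop) (hA'.prod MeasurableSet.univ)
  calc ENNReal.ofReal (∫ ω, ξ ω ^ 2 ∂μ) * μ (Z ⁻¹' A')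
      = ∫⁻ z in A', ENNReal.ofReal (∫ ω, ξ ω ^ 2 ∂μ) ∂(μ.map Z) := by
        rw [setLIntegral_const, Measure.map_apply hZ hA']
    _ ≤ ∫⁻ z in A', ∫⁻ x, ‖x + g' z‖ₑ ^ 2 ∂(μ.map ξ) ∂(μ.map Z) :=
        lintegral_mono fun z => hinner (g' z)
    _ = ∫⁻ z, ∫⁻ x, (A' ×ˢ Set.univ).indicator (fun p => ‖p.2 + g' p.1‖ₑ ^ 2) (z, x)
          ∂(μ.map ξ) ∂(μ.map Z) := by
        rw [← lintegral_indicator hA']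
        refine lintegral_congr fun z => ?_
        by_cases hz : z ∈ A' <;> simp [hz]
    _ = ∫⁻ p, (A' ×ˢ Set.univ).indicator (fun p => ‖p.2 + g' p.1‖ₑ ^ 2) p
          ∂((μ.map Z).prod (μ.map ξ)) := by
        rw [lintegral_prod _ hF.aemeasurable]
    _ = ∫⁻ ω in Z ⁻¹' A', ‖ξ ω + (g' ∘ Z) ω‖ₑ ^ 2 ∂μ := by
        rw [← hmap, lintegral_map hF (hZ.prodMk hξm), ← lintegral_indicator (hZ hA')]
        refine lintegral_congr fun ω => ?_
        by_cases hz : Z ω ∈ A' <;> simp [hz]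

/-! ### Reduction of adaptive schedules to deterministic paths. -/

section schedule

variable {Ω R : Type*} [MeasurableSpace R] {M : ℕ} {U : Ω → R}
  {x₀ : Ω → EuclideanSpace ℝ (Fin M)} {w : ℕ → Ω → EuclideanSpace ℝ (Fin M)}
  {c : ℕ → Ω → Fin M}

theorem measurable_rand_info (t : ℕ) : Measurable[info U x₀ w c t] U :=
  Measurable.mono (comap_measurable U) le_sup_left le_rfl

theorem measurable_sample_info {s t : ℕ} (hst : s < t) :
    Measurable[info U x₀ w c t] fun ω => (c s ω, state x₀ w s ω (c s ω)) :=
  Measurable.mono (comap_measurable _)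
    ((le_iSup (fun s : Fin t => MeasurableSpace.comap
      (fun ω => (c s ω, state x₀ w s ω (c s ω))) inferInstance) ⟨s, hst⟩).trans le_sup_right) le_rfl

theorem info_mono {s t : ℕ} (hst : s ≤ t) : info U x₀ w c s ≤ info U x₀ w c t := by
  refine sup_le_sup_left (iSup_le fun r => ?_) _
  exact le_iSup (fun r : Fin t => MeasurableSpace.comap
    (fun ω => (c r ω, state x₀ w r ω (c r ω))) inferInstance) ⟨r, r.2.trans_le hst⟩

/-- On the event that the schedule takes the decisions `d`, the information is that of the
deterministic schedule `d`. -/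
theorem measurableSet_info_inter (hc : IsObliviousSchedule U x₀ w c) (d : ℕ → Fin M) (t : ℕ) :
    ∀ B, MeasurableSet[info U x₀ w c t] B →
      MeasurableSet[info U x₀ w (fun s _ => d s) t] (B ∩ {ω | ∀ s < t, c s ω = d s}) := by
  have key : ∀ t, MeasurableSet[info U x₀ w (fun s _ => d s) t] {ω | ∀ s < t, c s ω = d s} →
      ∀ B, MeasurableSet[info U x₀ w c t] B →
      MeasurableSet[info U x₀ w (fun s _ => d s) t] (B ∩ {ω | ∀ s < t, c s ω = d s}) := by
    intro t hA
    let m : MeasurableSpace Ω := info U x₀ w (fun s _ => d s) t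
    set A := {ω | ∀ s < t, c s ω = d s}
    -- The sets whose trace on `A` is known to the deterministic schedule form a σ-algebra, so only
    -- the generators need checking.
    let m' : MeasurableSpace Ω :=
      { MeasurableSet' := fun B => MeasurableSet[m] (B ∩ A)
        measurableSet_empty := by simp
        measurableSet_compl := fun B hB => by
          have : Bᶜ ∩ A = A \ (B ∩ A) := by ext; simp; tauto
          rw [this]
          exact MeasurableSet.diff hA hB
        measurableSet_iUnion := fun f hf => by
          rw [Set.iUnion_inter]
          exact MeasurableSet.iUnion hf }
    have hle : info U x₀ w c t ≤ m' := by
      refine sup_le ?_ (iSup_le fun s => ?_)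
      · rintro _ ⟨B, hB, rfl⟩
        exact MeasurableSet.inter (measurable_rand_info (c := fun s _ => d s) t hB) hA
      · rintro _ ⟨B, hB, rfl⟩
        have h1 := measurable_sample_info (U := U) (x₀ := x₀) (w := w) (c := fun s _ => d s) s.2 hB
        have h2 : (fun ω => (c s ω, state x₀ w s ω (c s ω))) ⁻¹' B ∩ A
            = (fun ω => (d s, state x₀ w s ω (d s))) ⁻¹' B ∩ A := by
          ext ω
          simp only [Set.mem_inter_iff, Set.mem_preimage]
          refine and_congr_left fun hω => ?_
          rw [hω s s.2]
        change MeasurableSet[m] (_ ∩ A)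
        rw [h2]
        exact MeasurableSet.inter h1 hA
    exact fun B hB => hle B hB
  -- The decision of slot `t` is measurable in the information of slot `t`, so `key` at `t` yields
  -- the path event at `t + 1`.
  have hA : ∀ t, MeasurableSet[info U x₀ w (fun s _ => d s) t] {ω | ∀ s < t, c s ω = d s} := by
    intro t
    induction t with
    | zero => simp
    | succ t ih =>
      have h1 := key t ih _ (hc t (measurableSet_singleton (d t)))
      have h2 : {ω | ∀ s < t + 1, c s ω = d s}
          = c t ⁻¹' {d t} ∩ {ω | ∀ s < t, c s ω = d s} := by
        ext ω
        simp only [Set.mem_ofPred_eq, Set.mem_inter_iff, Set.mem_preimage, Set.mem_singleton_iff]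
        exact ⟨fun h => ⟨h t (by omega), fun s hs => h s (by omega)⟩,
          fun h s hs => by
            rcases Nat.lt_succ_iff_lt_or_eq.1 hs with h' | rfl
            exacts [h.2 s h', h.1]⟩
      rw [h2]
      exact info_mono (Nat.le_succ t) _ h1
  exact key t (hA t)

theorem measurable_indicator_info (hc : IsObliviousSchedule U x₀ w c) (d : ℕ → Fin M) (t : ℕ)
    {f : Ω → EuclideanSpace ℝ (Fin M)} (hf : Measurable[info U x₀ w c t] f) :
    Measurable[info U x₀ w (fun s _ => d s) t]
      ({ω | ∀ s < t, c s ω = d s}.indicator f) := by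
  set A := {ω | ∀ s < t, c s ω = d s}
  have hA : MeasurableSet[info U x₀ w (fun s _ => d s) t] A := by
    have := measurableSet_info_inter hc d t Set.univ MeasurableSet.univ
    rwa [Set.univ_inter] at this
  intro B hB
  have h1 := measurableSet_info_inter hc d t _ (hf hB)
  have h2 : A.indicator f ⁻¹' B = (f ⁻¹' B ∩ A) ∪ ((fun _ => (0 : EuclideanSpace ℝ (Fin M))) ⁻¹' B ∩ Aᶜ) := by
    ext ω
    by_cases hω : ω ∈ A <;> simp [hω]
  rw [h2]
  refine MeasurableSet.union h1 (MeasurableSet.inter ?_ hA.compl)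
  by_cases h0 : (0 : EuclideanSpace ℝ (Fin M)) ∈ B <;> simp [h0]

/-- The information of slot `t` involves the random coordinates read earlier, hence the strong
induction: earlier decisions must first be measurable in the ambient space. -/
theorem measurable_schedule [MeasurableSpace Ω]
    (hc : IsObliviousSchedule U x₀ w c) (hU : Measurable U)
    (hx : ∀ t, Measurable (state x₀ w t)) : ∀ t, Measurable (c t) ∧ info U x₀ w c t ≤ ‹_› := by
  intro t
  induction t using Nat.strong_induction_on with
  | _ t ih =>
    have hle : info U x₀ w c t ≤ ‹MeasurableSpace Ω› := by
      refine sup_le hU.comap_le (iSup_le fun s => ?_)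
      refine Measurable.comap_le ((ih s s.2).1.prodMk ?_)
      have h1 : Measurable fun p : EuclideanSpace ℝ (Fin M) × Fin M => p.1 p.2 :=
        measurable_from_prod_countable_left fun j => by
          change Measurable fun x : EuclideanSpace ℝ (Fin M) => x j
          fun_prop
      exact h1.comp ((hx s).prodMk (ih s s.2).1)
    exact ⟨(hc t).mono hle le_rfl, hle⟩

/-- A lower bound on every event on which the decisions up to slot `t` are fixed is a lower bound
on the mean. -/
theorem le_lintegral_of_forall_path [MeasurableSpace Ω] {μ : Measure Ω} [IsProbabilityMeasure μ]
    [NeZero M]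
    (hcm : ∀ t, Measurable (c t)) (t : ℕ) (f : Ω → ENNReal) (C : ENNReal)
    (h : ∀ d : ℕ → Fin M, C * μ {ω | ∀ s < t, c s ω = d s}
      ≤ ∫⁻ ω in {ω | ∀ s < t, c s ω = d s}, f ω ∂μ) :
    C ≤ ∫⁻ ω, f ω ∂μ := by
  let p : Ω → Fin t → Fin M := fun ω s => c s ω
  have hp : Measurable p := measurable_pi_iff.2 fun s => hcm s
  have hpre : ∀ e : Fin t → Fin M, ∃ d : ℕ → Fin M,
      p ⁻¹' {e} = {ω | ∀ s < t, c s ω = d s} := by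
    intro e
    -- The event ignores decisions from slot `t` on; `0` only fills them.
    refine ⟨fun s => if hs : s < t then e ⟨s, hs⟩ else 0, ?_⟩
    ext ω
    simp only [Set.mem_preimage, Set.mem_singleton_iff, Set.mem_ofPred_eq, funext_iff, p]
    exact ⟨fun h s hs => by simp [hs, h ⟨s, hs⟩], fun h s => by simpa using h s s.2⟩
  have hU : (⋃ e, p ⁻¹' {e}) = Set.univ := by ext; simp
  have hm : ∀ e, MeasurableSet (p ⁻¹' {e}) := fun e => hp (measurableSet_singleton e)
  have hd : Pairwise (Function.onFun Disjoint fun e => p ⁻¹' {e}) := fun e e' hne =>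
    Disjoint.preimage p (by simpa using hne)
  calc C = C * μ (⋃ e, p ⁻¹' {e}) := by rw [hU, measure_univ, mul_one]
    _ = ∑' e, C * μ (p ⁻¹' {e}) := by rw [measure_iUnion hd hm, ENNReal.tsum_mul_left]
    _ ≤ ∑' e, ∫⁻ ω in p ⁻¹' {e}, f ω ∂μ := by
        refine ENNReal.tsum_le_tsum fun e => ?_
        obtain ⟨d, hd⟩ := hpre e
        rw [hd]
        exact h d
    _ = ∫⁻ ω, f ω ∂μ := by rw [← lintegral_iUnion hm hd, hU, setLIntegral_univ]

end schedule

/-! ### The error left in one direction. -/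

section lower

open Matrix

theorem coefficients_apply_selected {M L : ℕ} {Q : Matrix (Fin M) (Fin M) ℝ} {S : Fin L ↪ Fin M}
    (hS : (Q.submatrix S S).rank = L) (i k : Fin L) :
    coefficients Q S (S i) k = (1 : Matrix (Fin L) (Fin L) ℝ) i k := by
  have hu := (isUnit_iff_isUnit_det _).1 (isUnit_of_rank_eq hS)
  rw [← mul_nonsing_inv _ hu]
  simp [coefficients, mul_apply]

/-- The vector with coordinates `u` on the selected sources and zero elsewhere. -/
def extend {M L : ℕ} (S : Fin L ↪ Fin M) (u : Fin L → ℝ) : EuclideanSpace ℝ (Fin M) :=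
  ∑ i, EuclideanSpace.single (S i) (u i)

theorem inner_extend {M L : ℕ} (S : Fin L ↪ Fin M) (u : Fin L → ℝ)
    (x : EuclideanSpace ℝ (Fin M)) : inner ℝ (extend S u) x = ∑ i, u i * x (S i) := by
  simp [extend, sum_inner, EuclideanSpace.inner_single_left]

theorem extend_vecMul {M L : ℕ} {Q : Matrix (Fin M) (Fin M) ℝ} {S : Fin L ↪ Fin M}
    (hS : (Q.submatrix S S).rank = L) (u : Fin L → ℝ) :
    (extend S u).ofLp ᵥ* coefficients Q S = u := by
  ext k
  have h := inner_extend S u (WithLp.toLp 2 fun j => coefficients Q S j k)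
  have h2 : inner ℝ (extend S u) (WithLp.toLp 2 fun j => coefficients Q S j k)
      = ((extend S u).ofLp ᵥ* coefficients Q S) k := by
    simp [EuclideanSpace.inner_eq_star_dotProduct, vecMul, dotProduct_comm]
  rw [← h2, h]
  simp [coefficients_apply_selected hS, Matrix.one_apply]

/-- A direction `u` which the sensors in `D` do not see keeps an innovation of variance at least
`λ_L(Q')` when these sensors are known. -/
theorem exists_innovation {M L : ℕ} (hL : 1 ≤ L) {Q : Matrix (Fin M) (Fin M) ℝ}
    (hQ : Q.PosSemidef) (hQL : Q.rank = L) {S : Fin L ↪ Fin M}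
    (hS : (Q.submatrix S S).rank = L) (D : Set (Fin M)) (u : Fin L → ℝ) (hu : u ⬝ᵥ u = 1)
    (hD : ∀ j ∈ D, u ⬝ᵥ coefficients Q S j = 0) :
    ∃ v : EuclideanSpace ℝ (Fin M), (∀ j ∉ D, v j = extend S u j) ∧
      (∀ j ∈ D, bilin Q v (EuclideanSpace.single j 1) = 0) ∧
      eigenvalue (hQ.submatrix S).isHermitian L ⟨hL, le_refl L⟩ ≤ bilin Q v v := by
  obtain ⟨v, hv, hvz⟩ := exists_sub_bilin_eq_zero hQ D (extend S u)
  refine ⟨v, hv, fun j hj => hvz _ fun i hi => ?_, ?_⟩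
  · have : i ≠ j := fun h => hi (h ▸ hj)
    simp [this]
  rw [bilin_eq_submatrix hQ hQL hS]
  set y := v.ofLp ᵥ* coefficients Q S with hy
  refine le_trans ?_ (eigenvalue_mul_le hL (hQ.submatrix S).isHermitian y)
  -- It suffices that `y` has norm at least one: `v - extend S u` lives on `D`, so `y = u + p` with
  -- `p` a combination of rows orthogonal to `u`.
  refine le_mul_of_one_le_right (eigenvalue_nonneg hL (hQ.submatrix S)) ?_
  set p := (v - extend S u).ofLp ᵥ* coefficients Q S with hp
  have hyp : y = u + p := by
    rw [hp, WithLp.ofLp_sub, sub_vecMul, extend_vecMul hS]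
    abel
  have hup : u ⬝ᵥ p = 0 := by
    rw [hp, dotProduct_comm, ← dotProduct_mulVec]
    refine Finset.sum_eq_zero fun j _ => ?_
    by_cases hj : j ∈ D
    · have := hD j hj
      rw [dotProduct_comm] at this
      simp [mulVec, this]
    · simp [hv j hj]
  have hpp : 0 ≤ p ⬝ᵥ p := Finset.sum_nonneg fun i _ => mul_self_nonneg _
  rw [hyp, add_dotProduct, dotProduct_add, dotProduct_add, dotProduct_comm p u, hup, hu]
  linarith

variable {Ω R : Type*} [MeasurableSpace Ω] [MeasurableSpace R] {M : ℕ} {μ : Measure Ω}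
  {m₀ : EuclideanSpace ℝ (Fin M)} {P₀ Q : Matrix (Fin M) (Fin M) ℝ} {U : Ω → R}
  {x₀ : Ω → EuclideanSpace ℝ (Fin M)} {w : ℕ → Ω → EuclideanSpace ℝ (Fin M)}

/-- With the last `k` reads blind to the direction `u`, the error in this direction is at least
`k λ_L(Q')`. -/
theorem IsGaussianWalk.le_lintegral_inner_sub [IsProbabilityMeasure μ]
    (hw : IsGaussianWalk μ m₀ P₀ Q U x₀ w)
    {L : ℕ} (hL : 1 ≤ L) (hQ : Q.PosSemidef) (hQL : Q.rank = L) {S : Fin L ↪ Fin M}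
    (hS : (Q.submatrix S S).rank = L) (d : ℕ → Fin M) {k t : ℕ} (hkt : k ≤ t)
    (u : Fin L → ℝ) (hu : u ⬝ᵥ u = 1)
    (hd : ∀ s, t < s + k → s ≤ t → u ⬝ᵥ coefficients Q S (d s) = 0)
    {A : Set Ω} (hA : MeasurableSet[info U x₀ w (fun s _ => d s) (t + 1)] A)
    {f : Ω → EuclideanSpace ℝ (Fin M)}
    (hf : Measurable[info U x₀ w (fun s _ => d s) (t + 1)] f) :
    ENNReal.ofReal (k * eigenvalue (hQ.submatrix S).isHermitian L ⟨hL, le_refl L⟩) * μ A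
      ≤ ∫⁻ ω in A, ‖(inner ℝ (extend S u) (state x₀ w t ω - f ω) : ℝ)‖ₑ ^ 2 ∂μ := by
  classical
  set D : Set (Fin M) := {j | ∃ s, t < s + k ∧ s ≤ t ∧ d s = j} with hDdef
  obtain ⟨v, hvu, hvD, hvv⟩ := exists_innovation hL hQ hQL hS D u hu
    (by rintro j ⟨s, h1, h2, rfl⟩; exact hd s h1 h2)
  -- The data revealed to the monitor: all coordinates of early increments, and those in `D` of late
  -- ones. A read before the last `k` slots involves early increments only.
  let known : ℕ → Fin M → Prop := fun r j => r + k < t ∨ j ∈ D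
  let vv : ℕ → EuclideanSpace ℝ (Fin M) := fun r => if r + k < t then 0 else v
  let y : Fin t × Fin M → ℕ → EuclideanSpace ℝ (Fin M) := fun p r =>
    if r = p.1 ∧ known p.1 p.2 then EuclideanSpace.single p.2 1 else 0
  have hy : ∀ p ω, incrForm w t (y p) ω = if known p.1 p.2 then w p.1 ω p.2 else 0 := by
    intro p ω
    unfold incrForm
    by_cases h : known p.1 p.2
    · simp only [y, h, and_true, if_true]
      rw [Finset.sum_eq_single_of_mem (p.1 : ℕ) (by simp) fun r _ hr => by simp [hr]]
      simp [EuclideanSpace.inner_single_left]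
    · simp [y, h]
  let Z : Ω → ((Fin t × Fin M → ℝ) × EuclideanSpace ℝ (Fin M)) × R :=
    fun ω => (((fun p => incrForm w t (y p) ω), x₀ ω), U ω)
  have hind : IndepFun (incrForm w t vv) Z μ := by
    refine hw.indepFun_incrForm_init_rand hQ t vv y fun p => Finset.sum_eq_zero fun r _ => ?_
    by_cases h1 : r + k < t
    · simp [vv, h1, bilin]
    by_cases h2 : r = p.1 ∧ known p.1 p.2
    · have h3 : p.2 ∈ D := h2.2.resolve_left (h2.1 ▸ h1)
      simp only [vv, y, if_neg h1, if_pos h2]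
      exact hvD _ h3
    · simp [y, h2, bilin]
  have hZ : Measurable Z :=
    ((measurable_pi_iff.2 fun p => hw.measurable_incrForm t (y p)).prodMk hw.measurable_init).prodMk
      hw.measurable_rand
  -- Everything in the error except the innovations. A late increment enters only through `extend S
  -- u - v`, which vanishes off `D`, so `g` is a function of the revealed data.
  let g : Ω → ℝ := fun ω => inner ℝ (extend S u) (x₀ ω)
    + ∑ r ∈ Finset.range t, ∑ j, (extend S u - vv r) j * w r ω j
    - inner ℝ (extend S u) (f ω)
  have hAg : MeasurableSet[MeasurableSpace.comap Z inferInstance] A ∧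
      Measurable[MeasurableSpace.comap Z inferInstance] g := by
    let mZ : MeasurableSpace Ω := MeasurableSpace.comap Z inferInstance
    have hZZ : Measurable[mZ] Z := comap_measurable Z
    have hx₀ : Measurable[mZ] x₀ := measurable_snd.comp (measurable_fst.comp hZZ)
    have hknown : ∀ r j, r < t → known r j → Measurable[mZ] fun ω => w r ω j := by
      intro r j hr hk
      have h1 : Measurable[mZ] fun ω => incrForm w t (y (⟨r, hr⟩, j)) ω :=
        (measurable_pi_apply _).comp (measurable_fst.comp (measurable_fst.comp hZZ))
      simpa [hy, hk] using h1
    have hle : info U x₀ w (fun s _ => d s) (t + 1) ≤ mZ := by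
      refine sup_le (Measurable.comap_le (measurable_snd.comp hZZ)) (iSup_le fun s => ?_)
      refine Measurable.comap_le (Measurable.prodMk measurable_const ?_)
      simp only [state, PiLp.add_apply, WithLp.ofLp_sum, Finset.sum_apply]
      have h0 : Measurable[mZ] fun ω => x₀ ω (d s) :=
        (by fun_prop : Measurable fun x : EuclideanSpace ℝ (Fin M) => x (d s)).comp hx₀
      refine Measurable.add h0 (Finset.measurable_sum _ fun r hr => ?_)
      have hr' := Finset.mem_range.1 hr
      have hs := s.2
      refine hknown r (d s) (by omega) ?_
      by_cases h : r + k < t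
      · exact Or.inl h
      · exact Or.inr ⟨s, by omega, by omega, rfl⟩
    have hinner : Measurable fun x : EuclideanSpace ℝ (Fin M) => (inner ℝ (extend S u) x : ℝ) := by
      fun_prop
    refine ⟨hle _ hA, ?_⟩
    refine Measurable.sub (Measurable.add (hinner.comp hx₀) ?_) (hinner.comp (hf.mono hle le_rfl))
    refine Finset.measurable_sum _ fun r hr => Finset.measurable_sum _ fun j _ => ?_
    by_cases h : known r j
    · exact (hknown r j (Finset.mem_range.1 hr) h).const_mul _
    · have h1 : ¬ r + k < t := fun h' => h (Or.inl h')
      have h2 : j ∉ D := fun h' => h (Or.inr h')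
      have h3 : (extend S u - vv r) j = 0 := by simp [vv, h1, hvu j h2]
      simp only [h3, zero_mul]
      exact measurable_const
  have hdecomp : ∀ ω, (inner ℝ (extend S u) (state x₀ w t ω - f ω) : ℝ)
      = incrForm w t vv ω + g ω := by
    intro ω
    have h1 : ∀ r, ∑ j, (extend S u - vv r) j * w r ω j
        = inner ℝ (extend S u) (w r ω) - inner ℝ (vv r) (w r ω) := by
      intro r
      rw [← inner_sub_left, PiLp.inner_apply]
      simp [mul_comm]
    simp only [g, h1, incrForm, state, inner_sub_right, inner_add_right, inner_sum,
      Finset.sum_sub_distrib]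
    ring
  simp_rw [hdecomp]
  refine le_trans ?_ (variance_mul_measure_le_lintegral (hw.measurable_incrForm t vv)
    (hw.memLp_incrForm t vv) (hw.integral_incrForm t vv) hZ hind hAg.1 hAg.2)
  gcongr
  rw [hw.integral_incrForm_sq hQ]
  have h1 : ∀ r ∈ Finset.range t, bilin Q (vv r) (vv r) =
      if r ∈ Finset.Ico (t - k) t then bilin Q v v else 0 := by
    intro r hr
    have := Finset.mem_range.1 hr
    by_cases h : r + k < t
    · have h' : ¬ (t ≤ r + k) := by omega
      simp [vv, h, h', bilin]
    · have h' : t ≤ r + k := by omega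
      simp [vv, h, h', this]
  rw [Finset.sum_congr rfl h1, ← Finset.sum_filter, Finset.sum_const, nsmul_eq_mul]
  have h2 : (Finset.range t).filter (fun r => r ∈ Finset.Ico (t - k) t)
      = Finset.Ico (t - k) t := by
    ext r; simp
  rw [h2, Nat.card_Ico]
  have h3 : t - (t - k) = k := by omega
  rw [h3]
  gcongr

end lower

/-! ### Long-run averages ignore a finite initial stretch. -/

theorem le_limsup_average {a : ℕ → ENNReal} {C : ℝ} (t₀ : ℕ)
    (h : ∀ t, t₀ ≤ t → ENNReal.ofReal C ≤ a t) :
    ENNReal.ofReal C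
      ≤ limsup (fun T : ℕ => (∑ t ∈ Finset.Icc 1 T, a t) / (T : ENNReal)) atTop := by
  have hlim : Tendsto (fun T : ℕ => ENNReal.ofReal (C * (1 - (t₀ : ℝ) / T))) atTop
      (nhds (ENNReal.ofReal C)) := by
    refine ENNReal.tendsto_ofReal ?_
    have := ((tendsto_const_div_atTop_nhds_zero_nat (t₀ : ℝ)).const_sub 1).const_mul C
    simpa using this
  refine hlim.limsup_eq.symm.le.trans (limsup_le_limsup ?_)
  filter_upwards [eventually_ge_atTop (t₀ + 1)] with T hT
  have hT0 : (0 : ℝ) < T := by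
    have : 0 < T := by omega
    exact_mod_cast this
  rw [ENNReal.le_div_iff_mul_le (by simp; omega) (by simp)]
  have h1 : (T - t₀ : ℕ) • ENNReal.ofReal C ≤ ∑ t ∈ Finset.Icc 1 T, a t := by
    calc (T - t₀ : ℕ) • ENNReal.ofReal C
        = ∑ t ∈ Finset.Icc (t₀ + 1) T, ENNReal.ofReal C := by simp
      _ ≤ ∑ t ∈ Finset.Icc (t₀ + 1) T, a t :=
        Finset.sum_le_sum fun t ht => h t (by have := Finset.mem_Icc.1 ht; omega)
      _ ≤ _ := Finset.sum_le_sum_of_subset (Finset.Icc_subset_Icc_left (by omega))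
  refine le_trans (le_of_eq ?_) h1
  rw [nsmul_eq_mul, ← ENNReal.ofReal_natCast, ← ENNReal.ofReal_natCast,
    ← ENNReal.ofReal_mul' (by positivity), ← ENNReal.ofReal_mul (by positivity),
    Nat.cast_sub (by omega)]
  congr 1
  field_simp

theorem limsup_average_le {a : ℕ → ENNReal} {e : ℕ → ℝ} {E₀ E : ℝ} (t₁ : ℕ)
    (ha : ∀ t, a t ≠ ⊤) (he : ∀ t, 0 ≤ e t) (h : ∀ t, t₁ ≤ t → a t ≤ ENNReal.ofReal (e t))
    (hsum : ∀ T : ℕ, ∑ t ∈ Finset.Icc 1 T, e t ≤ E₀ + E * T) :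
    limsup (fun T : ℕ => (∑ t ∈ Finset.Icc 1 T, a t) / (T : ENNReal)) atTop
      ≤ ENNReal.ofReal E := by
  set A : ℝ := ∑ t ∈ Finset.range t₁, (a t).toReal
  have hlim : Tendsto (fun T : ℕ => ENNReal.ofReal ((A + E₀) / T + E)) atTop
      (nhds (ENNReal.ofReal E)) := by
    refine ENNReal.tendsto_ofReal ?_
    simpa using (tendsto_const_div_atTop_nhds_zero_nat (A + E₀)).add_const E
  refine le_trans (limsup_le_limsup ?_) hlim.limsup_eq.le
  filter_upwards [eventually_ge_atTop 1] with T hT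
  have hT0 : (0 : ℝ) < T := by exact_mod_cast hT
  refine ENNReal.div_le_of_le_mul ?_
  have h1 : ∀ t, a t ≤ ENNReal.ofReal ((if t < t₁ then (a t).toReal else 0) + e t) := by
    intro t
    split_ifs with ht
    · rw [← ENNReal.ofReal_toReal (ha t)]
      exact ENNReal.ofReal_le_ofReal (by
        rw [ENNReal.toReal_ofReal ENNReal.toReal_nonneg]; linarith [he t])
    · simpa using h t (by omega)
  calc ∑ t ∈ Finset.Icc 1 T, a t
      ≤ ∑ t ∈ Finset.Icc 1 T, ENNReal.ofReal ((if t < t₁ then (a t).toReal else 0) + e t) :=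
        Finset.sum_le_sum fun t _ => h1 t
    _ = ENNReal.ofReal (∑ t ∈ Finset.Icc 1 T, ((if t < t₁ then (a t).toReal else 0) + e t)) := by
        rw [ENNReal.ofReal_sum_of_nonneg]
        intro t _
        have := he t
        positivity
    _ ≤ ENNReal.ofReal (((A + E₀) / T + E) * T) := by
        refine ENNReal.ofReal_le_ofReal ?_
        rw [Finset.sum_add_distrib, ← Finset.sum_filter]
        have h2 : ∑ t ∈ (Finset.Icc 1 T).filter (· < t₁), (a t).toReal ≤ A :=
          Finset.sum_le_sum_of_subset_of_nonneg (fun t ht => by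
            simpa using (Finset.mem_filter.1 ht).2) fun _ _ _ => ENNReal.toReal_nonneg
        have h3 : ((A + E₀) / T + E) * T = A + E₀ + E * T := by field_simp
        linarith [hsum T]
    _ = _ := by rw [ENNReal.ofReal_mul' hT0.le, ENNReal.ofReal_natCast]

/-! ### Summation over directions and the lower bound. -/

section lower

open Matrix

/-- Bessel's inequality for an orthonormal basis of the space of the selected sources. -/
theorem sum_enorm_inner_extend_le {M L : ℕ} (S : Fin L ↪ Fin M)
    (b : OrthonormalBasis (Fin L) ℝ (EuclideanSpace ℝ (Fin L))) (x : EuclideanSpace ℝ (Fin M)) :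
    ∑ k, ‖(inner ℝ (extend S (b k).ofLp) x : ℝ)‖ₑ ^ 2 ≤ ‖x‖ₑ ^ 2 := by
  have h1 : ∀ k, (inner ℝ (extend S (b k).ofLp) x : ℝ)
      = inner ℝ (b k) (WithLp.toLp 2 fun i => x (S i)) := by
    intro k
    rw [inner_extend, PiLp.inner_apply]
    simp [mul_comm]
  have h2 : ∀ r : ℝ, ‖r‖ₑ ^ 2 = ENNReal.ofReal (r ^ 2) := fun r => by
    rw [Real.enorm_eq_ofReal_abs, ← ENNReal.ofReal_pow (abs_nonneg _), sq_abs]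
  have h3 : ‖x‖ₑ ^ 2 = ENNReal.ofReal (‖x‖ ^ 2) := by
    rw [← ofReal_norm, ENNReal.ofReal_pow (norm_nonneg _)]
  simp_rw [h1, h2]
  rw [← ENNReal.ofReal_sum_of_nonneg fun _ _ => sq_nonneg _, b.sum_sq_inner_right, h3]
  refine ENNReal.ofReal_le_ofReal ?_
  rw [EuclideanSpace.real_norm_sq_eq, EuclideanSpace.real_norm_sq_eq]
  calc ∑ i, x (S i) ^ 2 = ∑ j ∈ Finset.univ.map S, x j ^ 2 := by rw [Finset.sum_map]
    _ ≤ ∑ j, x j ^ 2 :=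
      Finset.sum_le_sum_of_subset_of_nonneg (Finset.subset_univ _) fun _ _ _ => sq_nonneg _

variable {Ω R : Type*} [MeasurableSpace Ω] [MeasurableSpace R] {M : ℕ} {μ : Measure Ω}
  {m₀ : EuclideanSpace ℝ (Fin M)} {P₀ Q : Matrix (Fin M) (Fin M) ℝ} {U : Ω → R}
  {x₀ : Ω → EuclideanSpace ℝ (Fin M)} {w : ℕ → Ω → EuclideanSpace ℝ (Fin M)}

theorem IsGaussianWalk.le_setLIntegral_error [IsProbabilityMeasure μ]
    (hw : IsGaussianWalk μ m₀ P₀ Q U x₀ w)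
    {L : ℕ} (hL : 1 ≤ L) (hQ : Q.PosSemidef) (hQL : Q.rank = L) {S : Fin L ↪ Fin M}
    (hS : (Q.submatrix S S).rank = L) (d : ℕ → Fin M) {t : ℕ} (hLt : L ≤ t)
    {A : Set Ω} (hA : MeasurableSet[info U x₀ w (fun s _ => d s) (t + 1)] A)
    {f : Ω → EuclideanSpace ℝ (Fin M)} (hfm : Measurable f)
    (hf : Measurable[info U x₀ w (fun s _ => d s) (t + 1)] f) :
    ENNReal.ofReal ((L : ℝ) * (L - 1) / 2
        * eigenvalue (hQ.submatrix S).isHermitian L ⟨hL, le_refl L⟩) * μ A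
      ≤ ∫⁻ ω in A, ‖state x₀ w t ω - f ω‖ₑ ^ 2 ∂μ := by
  set lam := eigenvalue (hQ.submatrix S).isHermitian L ⟨hL, le_refl L⟩
  have hlam : 0 ≤ lam := eigenvalue_nonneg hL (hQ.submatrix S)
  -- The row read `i` slots ago. Repeated reads may make these vectors dependent; the Gram–Schmidt
  -- basis is complete all the same.
  let h : Fin L → EuclideanSpace ℝ (Fin L) := fun i =>
    WithLp.toLp 2 (coefficients Q S (d (t - i)))
  let b := InnerProductSpace.gramSchmidtOrthonormalBasis (𝕜 := ℝ)
    (by simp : Module.finrank ℝ (EuclideanSpace ℝ (Fin L)) = Fintype.card (Fin L)) h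
  have hstep : ∀ k : Fin L, ENNReal.ofReal ((k : ℕ) * lam) * μ A
      ≤ ∫⁻ ω in A, ‖(inner ℝ (extend S (b k).ofLp) (state x₀ w t ω - f ω) : ℝ)‖ₑ ^ 2 ∂μ := by
    intro k
    refine hw.le_lintegral_inner_sub hL hQ hQL hS d (k.2.le.trans hLt) (b k).ofLp ?_ ?_ hA hf
    · have h1 : (inner ℝ (b k) (b k) : ℝ) = 1 := by
        rw [real_inner_self_eq_norm_sq, b.orthonormal.1 k, one_pow]
      rwa [EuclideanSpace.inner_eq_star_dotProduct, star_trivial] at h1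
    · intro s hs hst
      have hk := k.2
      have h1 : (inner ℝ (b k) (h ⟨t - s, by omega⟩) : ℝ) = 0 :=
        InnerProductSpace.gramSchmidtOrthonormalBasis_inv_triangular _ h
          (by rw [Fin.lt_def]; simp only; omega)
      have h2 : t - (t - s) = s := by omega
      simpa [h, h2, EuclideanSpace.inner_eq_star_dotProduct, dotProduct_comm] using h1
  have hsum : ∑ k : Fin L, ((k : ℕ) : ℝ) * lam = (L : ℝ) * (L - 1) / 2 * lam := by
    rw [← Finset.sum_mul, Fin.sum_univ_eq_sum_range (fun k => (k : ℝ)) L]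
    congr 1
    have := Finset.sum_range_id_mul_two L
    have h2 : ((∑ k ∈ Finset.range L, k : ℕ) : ℝ) * 2 = (L : ℝ) * (L - 1) := by
      have h3 := congrArg (Nat.cast : ℕ → ℝ) this
      push_cast [Nat.cast_sub hL] at h3 ⊢
      exact h3
    rw [← h2]
    push_cast
    ring
  calc ENNReal.ofReal ((L : ℝ) * (L - 1) / 2 * lam) * μ A
      = ∑ k : Fin L, ENNReal.ofReal ((k : ℕ) * lam) * μ A := by
        rw [← hsum, ENNReal.ofReal_sum_of_nonneg fun k _ => by positivity, Finset.sum_mul]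
    _ ≤ ∑ k : Fin L, ∫⁻ ω in A,
          ‖(inner ℝ (extend S (b k).ofLp) (state x₀ w t ω - f ω) : ℝ)‖ₑ ^ 2 ∂μ :=
        Finset.sum_le_sum fun k _ => hstep k
    _ = ∫⁻ ω in A, ∑ k : Fin L,
          ‖(inner ℝ (extend S (b k).ofLp) (state x₀ w t ω - f ω) : ℝ)‖ₑ ^ 2 ∂μ := by
        have := hw.measurable_state t
        rw [lintegral_finsetSum]
        intro k _
        fun_prop
    _ ≤ _ := lintegral_mono fun ω => sum_enorm_inner_extend_le S b _

theorem IsGaussianWalk.le_lintegral_error [IsProbabilityMeasure μ]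
    (hw : IsGaussianWalk μ m₀ P₀ Q U x₀ w)
    {L : ℕ} (hL : 1 ≤ L) (hLM : L < M) (hQ : Q.PosSemidef) (hQL : Q.rank = L) {S : Fin L ↪ Fin M}
    (hS : (Q.submatrix S S).rank = L) {c : ℕ → Ω → Fin M} (hc : IsObliviousSchedule U x₀ w c)
    {xhat : ℕ → Ω → EuclideanSpace ℝ (Fin M)} (hx : IsEstimator U x₀ w c xhat)
    {t : ℕ} (hLt : L ≤ t) :
    ENNReal.ofReal ((L : ℝ) * (L - 1) / 2
        * eigenvalue (hQ.submatrix S).isHermitian L ⟨hL, le_refl L⟩)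
      ≤ ∫⁻ ω, ‖state x₀ w t ω - xhat t ω‖ₑ ^ 2 ∂μ := by
  have : NeZero M := ⟨by omega⟩
  have hm := measurable_schedule hc hw.measurable_rand hw.measurable_state
  refine le_lintegral_of_forall_path (fun s => (hm s).1) (t + 1) _ _ fun d => ?_
  set A := {ω | ∀ s < t + 1, c s ω = d s}
  have hA : MeasurableSet[info U x₀ w (fun s _ => d s) (t + 1)] A := by
    have := measurableSet_info_inter hc d (t + 1) Set.univ MeasurableSet.univ
    rwa [Set.univ_inter] at this
  have hd : IsObliviousSchedule U x₀ w (fun s _ => d s) := fun s => measurable_const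
  have hle := (measurable_schedule hd hw.measurable_rand hw.measurable_state (t + 1)).2
  have hf := measurable_indicator_info hc d (t + 1) (hx t)
  refine (hw.le_setLIntegral_error hL hQ hQL hS d hLt hA
    (hf.mono hle le_rfl) hf).trans (le_of_eq ?_)
  refine setLIntegral_congr_fun (hle _ hA) fun ω hω => ?_
  change ‖state x₀ w t ω - A.indicator (xhat t) ω‖ₑ ^ 2 = _
  rw [Set.indicator_of_mem hω]

theorem IsGaussianWalk.le_optimalError [IsProbabilityMeasure μ]
    (hw : IsGaussianWalk μ m₀ P₀ Q U x₀ w)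
    {L : ℕ} (hL : 1 ≤ L) (hLM : L < M) (hQ : Q.PosSemidef) (hQL : Q.rank = L) {S : Fin L ↪ Fin M}
    (hS : (Q.submatrix S S).rank = L) :
    ENNReal.ofReal ((L : ℝ) * (L + 1) / 2
        * eigenvalue (hQ.submatrix S).isHermitian L ⟨hL, le_refl L⟩ - Q.trace)
      ≤ optimalError μ U x₀ w := by
  set lam := eigenvalue (hQ.submatrix S).isHermitian L ⟨hL, le_refl L⟩
  have htr : L * lam ≤ Q.trace := by
    calc L * lam = ∑ i : Fin L, lam := by simp
      _ ≤ ∑ i : Fin L, Q (S i) (S i) :=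
        Finset.sum_le_sum fun i _ => eigenvalue_le_diag hL (hQ.submatrix S).isHermitian i
      _ = ∑ j ∈ Finset.univ.map S, Q j j := by rw [Finset.sum_map]
      _ ≤ ∑ j, Q j j := Finset.sum_le_sum_of_subset_of_nonneg (Finset.subset_univ _)
          fun _ _ _ => hQ.diag_nonneg
      _ = Q.trace := rfl
  refine le_iInf₂ fun c hc => le_iInf₂ fun xhat hx => ?_
  refine le_trans (ENNReal.ofReal_le_ofReal ?_)
    (le_limsup_average L fun t ht => hw.le_lintegral_error hL hLM hQ hQL hS hc hx ht)
  change _ ≤ (L : ℝ) * (L - 1) / 2 * lam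
  linarith

end lower

/-! ### The hold estimator and its mean square error. -/

section upper

open Matrix

theorem bilin_single_ite {M : ℕ} (Q : Matrix (Fin M) (Fin M) ℝ) (i : Fin M) (p q : Prop)
    [Decidable p] [Decidable q] :
    bilin Q (if p then EuclideanSpace.single i 1 else 0) (if q then EuclideanSpace.single i 1 else 0)
      = if p ∧ q then Q i i else 0 := by
  by_cases hp : p <;> by_cases hq : q <;> simp [hp, hq, bilin]

theorem state_sub_state {Ω : Type*} {M : ℕ} {x₀ : Ω → EuclideanSpace ℝ (Fin M)}
    {w : ℕ → Ω → EuclideanSpace ℝ (Fin M)} {s t T : ℕ} (hst : s ≤ t) (htT : t ≤ T) (i : Fin M)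
    (ω : Ω) : state x₀ w t ω i - state x₀ w s ω i
      = incrForm w T (fun r => if s ≤ r ∧ r < t then EuclideanSpace.single i 1 else 0) ω := by
  have h1 : ∀ r, (inner ℝ (if s ≤ r ∧ r < t then EuclideanSpace.single i (1 : ℝ) else 0) (w r ω) : ℝ)
      = if s ≤ r ∧ r < t then w r ω i else 0 := by
    intro r
    split_ifs <;> simp [EuclideanSpace.inner_single_left]
  have h2 : (Finset.range T).filter (fun r => s ≤ r ∧ r < t) = Finset.Ico s t := by
    ext r; simp; omega
  simp only [incrForm, h1, state, PiLp.add_apply, WithLp.ofLp_sum, Finset.sum_apply]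
  rw [← Finset.sum_filter, h2, Finset.sum_Ico_eq_sub _ hst]
  ring

/-- The constant by which source `j` differs from its combination of the selected sources. -/
def offset {Ω : Type*} {M L : ℕ} (Q : Matrix (Fin M) (Fin M) ℝ) (S : Fin L ↪ Fin M)
    (x₀ : Ω → EuclideanSpace ℝ (Fin M)) (j : Fin M) (ω : Ω) : ℝ :=
  x₀ ω j - ∑ i, coefficients Q S j i * x₀ ω (S i)

/-- The estimate under a deterministic schedule `d`: the offset is learnt by averaging over `N`
initial blocks of `L + M` slots, and each selected source is held at the value read last, in slot
`r t i`. Before slot `t₁` the estimate is zero. -/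
def holdEstimator {Ω : Type*} {M L : ℕ} (H : Matrix (Fin M) (Fin L) ℝ) (S : Fin L ↪ Fin M)
    (x₀ : Ω → EuclideanSpace ℝ (Fin M)) (w : ℕ → Ω → EuclideanSpace ℝ (Fin M)) (N t₁ : ℕ)
    (r : ℕ → Fin L → ℕ) (t : ℕ) (ω : Ω) : EuclideanSpace ℝ (Fin M) :=
  if t₁ ≤ t then WithLp.toLp 2 fun j =>
    (∑ n ∈ Finset.range N, (state x₀ w (n * (L + M) + (L + j)) ω j
      - ∑ i, H j i * state x₀ w (n * (L + M) + i) ω (S i))) / N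
    + ∑ i, H j i * state x₀ w (r t i) ω (S i)
  else 0

theorem isEstimator_holdEstimator {Ω R : Type*} [MeasurableSpace R] {M L : ℕ} {U : Ω → R}
    {x₀ : Ω → EuclideanSpace ℝ (Fin M)} {w : ℕ → Ω → EuclideanSpace ℝ (Fin M)} (H : Matrix (Fin M) (Fin L) ℝ) (S : Fin L ↪ Fin M)
    {d : ℕ → Fin M} {N t₁ : ℕ} {r : ℕ → Fin L → ℕ}
    (hd₁ : ∀ n < N, ∀ i : Fin L, d (n * (L + M) + i) = S i)
    (hd₂ : ∀ n < N, ∀ j : Fin M, d (n * (L + M) + (L + j)) = j)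
    (ht₁ : N * (L + M) ≤ t₁) (hr : ∀ t, t₁ ≤ t → ∀ i, r t i ≤ t ∧ d (r t i) = S i) :
    IsEstimator U x₀ w (fun s _ => d s) (holdEstimator H S x₀ w N t₁ r) := by
  intro t
  let _ : MeasurableSpace Ω := info U x₀ w (fun s _ => d s) (t + 1)
  have hsample : ∀ s j, s ≤ t → d s = j →
      Measurable[info U x₀ w (fun s _ => d s) (t + 1)] fun ω => state x₀ w s ω j := by
    rintro s j hs rfl
    exact measurable_snd.comp (measurable_sample_info (U := U) (x₀ := x₀) (w := w)
      (c := fun s _ => d s) (Nat.lt_succ_of_le hs))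
  unfold holdEstimator
  by_cases ht : t₁ ≤ t
  · simp only [ht, if_true]
    have hle : ∀ n ∈ Finset.range N, ∀ k, k < L + M → n * (L + M) + k ≤ t := by
      intro n hn k hk
      have h1 : (n + 1) * (L + M) ≤ N * (L + M) :=
        Nat.mul_le_mul_right _ (Finset.mem_range.1 hn)
      rw [add_mul] at h1
      omega
    refine (WithLp.measurable_toLp 2 _).comp (measurable_pi_iff.2 fun j => ?_)
    refine Measurable.add (Measurable.div_const (Finset.measurable_sum _ fun n hn =>
      Measurable.sub (hsample _ _ (hle n hn _ (by omega)) (hd₂ n (Finset.mem_range.1 hn) j))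
        (Finset.measurable_sum _ fun i _ => Measurable.const_mul
          (hsample _ _ (hle n hn _ (by omega)) (hd₁ n (Finset.mem_range.1 hn) i)) _)) _)
      (Finset.measurable_sum _ fun i _ => Measurable.const_mul
        (hsample _ _ (hr t ht i).1 (hr t ht i).2) _)
  · simp only [ht, if_false]
    exact measurable_const

variable {Ω R : Type*} [MeasurableSpace Ω] [MeasurableSpace R] {M : ℕ} {μ : Measure Ω}
  {m₀ : EuclideanSpace ℝ (Fin M)} {P₀ Q : Matrix (Fin M) (Fin M) ℝ} {U : Ω → R}
  {x₀ : Ω → EuclideanSpace ℝ (Fin M)} {w : ℕ → Ω → EuclideanSpace ℝ (Fin M)}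

/-- The difference of the two sides is a form along a null vector of `Q`, so it has variance zero.
-/
theorem IsGaussianWalk.ae_incr_eq [IsProbabilityMeasure μ]
    (hw : IsGaussianWalk μ m₀ P₀ Q U x₀ w)
    {L : ℕ} (hQ : Q.PosSemidef) (hQL : Q.rank = L) {S : Fin L ↪ Fin M}
    (hS : (Q.submatrix S S).rank = L) (r : ℕ) (j : Fin M) :
    ∀ᵐ ω ∂μ, w r ω j = ∑ i, coefficients Q S j i * w r ω (S i) := by
  set v : EuclideanSpace ℝ (Fin M) :=
    EuclideanSpace.single j 1 - extend S (coefficients Q S j) with hv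
  have hvH : v.ofLp ᵥ* coefficients Q S = 0 := by
    rw [hv, WithLp.ofLp_sub, sub_vecMul, extend_vecMul hS]
    ext k
    simp
  have hvv : bilin Q v v = 0 := by
    rw [bilin_eq_submatrix hQ hQL hS, hvH]
    simp
  have hint : ∫ ω, (inner ℝ v (w r ω) : ℝ) ^ 2 ∂μ = 0 := by
    have := hw.integral_incrForm_sq hQ (r + 1) (fun q => if q = r then v else 0)
    have h1 : ∀ ω, incrForm w (r + 1) (fun q => if q = r then v else 0) ω = inner ℝ v (w r ω) := by
      intro ω
      unfold incrForm
      rw [Finset.sum_eq_single_of_mem r (by simp) fun q _ hq => by simp [hq]]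
      simp
    simp_rw [h1] at this
    rw [this]
    refine Finset.sum_eq_zero fun q _ => ?_
    by_cases hq : q = r
    · simp [hq, hvv]
    · simp [hq, bilin]
  have h0 := (integral_eq_zero_iff_of_nonneg (fun ω => sq_nonneg _)
    (hw.memLp_inner r v).integrable_sq).1 hint
  filter_upwards [h0] with ω hω
  have h1 : (inner ℝ v (w r ω) : ℝ) = 0 := by simpa using hω
  rw [hv, inner_sub_left, inner_extend, EuclideanSpace.inner_single_left] at h1
  simp only [map_one, one_mul] at h1
  linarith

theorem IsGaussianWalk.ae_state_eq [IsProbabilityMeasure μ]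
    (hw : IsGaussianWalk μ m₀ P₀ Q U x₀ w)
    {L : ℕ} (hQ : Q.PosSemidef) (hQL : Q.rank = L) {S : Fin L ↪ Fin M}
    (hS : (Q.submatrix S S).rank = L) :
    ∀ᵐ ω ∂μ, ∀ t j, state x₀ w t ω j
      = offset Q S x₀ j ω + ∑ i, coefficients Q S j i * state x₀ w t ω (S i) := by
  filter_upwards [ae_all_iff.2 fun r => ae_all_iff.2 fun j => hw.ae_incr_eq hQ hQL hS r j]
    with ω hω t j
  simp only [state, offset, PiLp.add_apply, WithLp.ofLp_sum, Finset.sum_apply, mul_add,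
    Finset.sum_add_distrib, Finset.mul_sum]
  rw [Finset.sum_comm (s := Finset.univ)]
  simp_rw [← hω]
  ring

theorem IsGaussianWalk.memLp_state_sub [IsProbabilityMeasure μ]
    (hw : IsGaussianWalk μ m₀ P₀ Q U x₀ w) {s t : ℕ} (hst : s ≤ t) (i : Fin M) :
    MemLp (fun ω => state x₀ w t ω i - state x₀ w s ω i) 2 μ := by
  simp_rw [state_sub_state hst le_rfl]
  exact hw.memLp_incrForm _ _

theorem IsGaussianWalk.integral_state_sub_sq [IsProbabilityMeasure μ]
    (hw : IsGaussianWalk μ m₀ P₀ Q U x₀ w) (hQ : Q.PosSemidef) {s t : ℕ} (hst : s ≤ t)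
    (i : Fin M) :
    ∫ ω, (state x₀ w t ω i - state x₀ w s ω i) ^ 2 ∂μ = ((t - s : ℕ) : ℝ) * Q i i := by
  simp_rw [state_sub_state hst le_rfl]
  rw [hw.integral_incrForm_sq hQ]
  simp_rw [bilin_single_ite, and_self]
  have h2 : (Finset.range t).filter (fun r => s ≤ r ∧ r < t) = Finset.Ico s t := by
    ext r; simp
  rw [← Finset.sum_filter, h2, Finset.sum_const, Nat.card_Ico, nsmul_eq_mul]

/-- The increments over disjoint windows average out. -/
theorem IsGaussianWalk.integral_sum_state_sub_sq [IsProbabilityMeasure μ]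
    (hw : IsGaussianWalk μ m₀ P₀ Q U x₀ w) (hQ : Q.PosSemidef) {m p B : ℕ} (hmp : m ≤ p)
    (hpB : p ≤ B) (N : ℕ) (i : Fin M) :
    ∫ ω, (∑ n ∈ Finset.range N,
      (state x₀ w (n * B + p) ω i - state x₀ w (n * B + m) ω i)) ^ 2 ∂μ
        = N * ((p - m : ℕ) : ℝ) * Q i i := by
  have hle : ∀ n ∈ Finset.range N, n * B + p ≤ N * B := by
    intro n hn
    have h1 : n + 1 ≤ N := Finset.mem_range.1 hn
    calc n * B + p ≤ n * B + B := by omega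
      _ = (n + 1) * B := by ring
      _ ≤ N * B := Nat.mul_le_mul_right _ h1
  let v : ℕ → ℕ → EuclideanSpace ℝ (Fin M) := fun n r =>
    if n * B + m ≤ r ∧ r < n * B + p then EuclideanSpace.single i 1 else 0
  have hsum : ∀ ω, ∑ n ∈ Finset.range N,
      (state x₀ w (n * B + p) ω i - state x₀ w (n * B + m) ω i)
      = incrForm w (N * B) (fun r => ∑ n ∈ Finset.range N, v n r) ω := by
    intro ω
    simp only [incrForm, sum_inner]
    rw [Finset.sum_comm]
    exact Finset.sum_congr rfl fun n hn => state_sub_state (by omega) (hle n hn) i ω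
  simp_rw [hsum]
  have hsq : ∫ ω, incrForm w (N * B) (fun r => ∑ n ∈ Finset.range N, v n r) ω ^ 2 ∂μ
      = ∑ n ∈ Finset.range N, ∑ n' ∈ Finset.range N,
        cov[incrForm w (N * B) (v n), incrForm w (N * B) (v n'); μ] := by
    rw [← covariance_fun_sum_fun_sum' (fun n _ => hw.memLp_incrForm _ (v n))
      (fun n _ => hw.memLp_incrForm _ (v n)), hw.integral_incrForm_sq hQ,
      ← hw.covariance_incrForm hQ]
    have : (fun ω => ∑ n ∈ Finset.range N, incrForm w (N * B) (v n) ω)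
        = incrForm w (N * B) (fun r => ∑ n ∈ Finset.range N, v n r) := by
      ext ω
      simp only [incrForm, sum_inner]
      rw [Finset.sum_comm]
    rw [this]
  rw [hsq]
  have hterm : ∀ n ∈ Finset.range N, ∑ n' ∈ Finset.range N,
      cov[incrForm w (N * B) (v n), incrForm w (N * B) (v n'); μ]
        = ((p - m : ℕ) : ℝ) * Q i i := by
    intro n hn
    rw [Finset.sum_eq_single_of_mem n hn]
    · rw [hw.covariance_incrForm hQ]
      simp_rw [v, bilin_single_ite, and_self]
      have h1 := hle n hn
      have h2 : (Finset.range (N * B)).filter (fun r => n * B + m ≤ r ∧ r < n * B + p)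
          = Finset.Ico (n * B + m) (n * B + p) := by
        ext r; simp only [Finset.mem_filter, Finset.mem_range, Finset.mem_Ico]; omega
      have h3 : n * B + p - (n * B + m) = p - m := by omega
      rw [← Finset.sum_filter, h2, Finset.sum_const, Nat.card_Ico, nsmul_eq_mul, h3]
    · intro n' _ hne
      rw [hw.covariance_incrForm hQ]
      simp_rw [v, bilin_single_ite]
      -- Since `p ≤ B`, windows from different blocks cannot share a slot.
      refine Finset.sum_eq_zero fun r _ => if_neg ?_
      rintro ⟨⟨h1, h2⟩, h3, h4⟩
      rcases Nat.lt_or_gt_of_ne hne with h | h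
      · have : (n' + 1) * B ≤ n * B := Nat.mul_le_mul_right _ h
        rw [add_mul] at this
        omega
      · have : (n + 1) * B ≤ n' * B := Nat.mul_le_mul_right _ h
        rw [add_mul] at this
        omega
  rw [Finset.sum_congr rfl hterm, Finset.sum_const, Finset.card_range, nsmul_eq_mul]
  ring

theorem IsGaussianWalk.lintegral_state_ne_top [IsProbabilityMeasure μ]
    (hw : IsGaussianWalk μ m₀ P₀ Q U x₀ w) (t : ℕ) :
    ∫⁻ ω, ‖state x₀ w t ω‖ₑ ^ 2 ∂μ ≠ ⊤ := by
  have h : MemLp (state x₀ w t) 2 μ :=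
    hw.law_init.hasGaussianLaw.memLp_two.add
      (memLp_finsetSum _ fun s _ => (hw.law_incr s).hasGaussianLaw.memLp_two)
  have := (lintegral_rpow_enorm_lt_top_of_eLpNorm_lt_top (by norm_num) (by norm_num)
    h.eLpNorm_lt_top).ne
  simpa using this

/-- The error in coordinate `j` is `∑ H j i * (e i - Y j i)`: `e` is the movement since the last
read, `Y` the noise of the learnt offset. Cauchy–Schwarz yields `∑ H²`, and `(e - Y)² ≤ 2 (e² + Y²)`
the factor `2`. -/
theorem IsGaussianWalk.lintegral_holdEstimator_le [IsProbabilityMeasure μ]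
    (hw : IsGaussianWalk μ m₀ P₀ Q U x₀ w)
    {L : ℕ} (hQ : Q.PosSemidef) (hQL : Q.rank = L) {S : Fin L ↪ Fin M}
    (hS : (Q.submatrix S S).rank = L) {N t₁ : ℕ} (hN : 0 < N) {r : ℕ → Fin L → ℕ} {t : ℕ}
    (ht : t₁ ≤ t) (hr : ∀ i, r t i ≤ t) :
    ∫⁻ ω, ‖state x₀ w t ω - holdEstimator (coefficients Q S) S x₀ w N t₁ r t ω‖ₑ ^ 2 ∂μ
      ≤ ENNReal.ofReal (2 * (∑ j, ∑ i, coefficients Q S j i ^ 2)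
        * ∑ i, Q (S i) (S i) * ((t - r t i : ℕ) + ((L + M : ℕ) : ℝ) / N)) := by
  set H := coefficients Q S
  have hN' : (0 : ℝ) < N := by exact_mod_cast hN
  let e : Fin L → Ω → ℝ := fun i ω => state x₀ w t ω (S i) - state x₀ w (r t i) ω (S i)
  let Y : Fin M → Fin L → Ω → ℝ := fun j i ω => (∑ n ∈ Finset.range N,
    (state x₀ w (n * (L + M) + (L + j)) ω (S i) - state x₀ w (n * (L + M) + i) ω (S i))) / N
  have heL : ∀ i, MemLp (e i) 2 μ := fun i => hw.memLp_state_sub (hr i) (S i)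
  have hYL : ∀ j i, MemLp (Y j i) 2 μ := by
    intro j i
    have h1 : MemLp (fun ω => ∑ n ∈ Finset.range N,
        (state x₀ w (n * (L + M) + (L + j)) ω (S i) - state x₀ w (n * (L + M) + i) ω (S i))) 2 μ :=
      memLp_finsetSum _ fun n _ => hw.memLp_state_sub (by omega) (S i)
    simpa only [Y, div_eq_inv_mul] using h1.const_mul (N : ℝ)⁻¹
  have heI : ∀ i, ∫ ω, e i ω ^ 2 ∂μ = ((t - r t i : ℕ) : ℝ) * Q (S i) (S i) :=
    fun i => hw.integral_state_sub_sq hQ (hr i) (S i)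
  have hYI : ∀ j i, ∫ ω, Y j i ω ^ 2 ∂μ ≤ ((L + M : ℕ) : ℝ) / N * Q (S i) (S i) := by
    intro j i
    simp only [Y, div_pow]
    rw [integral_div, hw.integral_sum_state_sub_sq hQ (by omega) (by omega)]
    have h1 : ((L + j - i : ℕ) : ℝ) ≤ ((L + M : ℕ) : ℝ) := by
      have := j.2
      exact_mod_cast (by omega)
    have h2 : 0 ≤ Q (S i) (S i) := hQ.diag_nonneg
    rw [div_mul_eq_mul_div, sq, mul_assoc, mul_div_mul_left _ _ hN'.ne']
    gcongr
  have hdec : ∀ᵐ ω ∂μ, ∀ j,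
      (state x₀ w t ω - holdEstimator H S x₀ w N t₁ r t ω) j = ∑ i, H j i * (e i ω - Y j i ω) := by
    filter_upwards [hw.ae_state_eq hQ hQL hS] with ω hω j
    have h1 : (∑ n ∈ Finset.range N, (state x₀ w (n * (L + M) + (L + j)) ω j
        - ∑ i, H j i * state x₀ w (n * (L + M) + i) ω (S i))) / N
        = offset Q S x₀ j ω + ∑ i, H j i * Y j i ω := by
      have h2 : ∀ n, state x₀ w (n * (L + M) + (L + j)) ω j
          - ∑ i, H j i * state x₀ w (n * (L + M) + i) ω (S i)
          = offset Q S x₀ j ω + ∑ i, H j i * (state x₀ w (n * (L + M) + (L + j)) ω (S i)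
            - state x₀ w (n * (L + M) + i) ω (S i)) := by
        intro n
        rw [hω _ j]
        simp only [mul_sub, Finset.sum_sub_distrib]
        ring
      simp only [h2, Y]
      rw [Finset.sum_add_distrib, Finset.sum_comm, Finset.sum_const, Finset.card_range,
        nsmul_eq_mul, add_div, mul_div_cancel_left₀ _ hN'.ne', Finset.sum_div]
      congr 1
      refine Finset.sum_congr rfl fun i _ => ?_
      rw [← Finset.mul_sum, mul_div_assoc]
    simp only [holdEstimator, ht, if_true, PiLp.sub_apply, h1]
    rw [hω t j]
    simp only [e, mul_sub, Finset.sum_sub_distrib]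
    ring
  have hpt : ∀ᵐ ω ∂μ, ‖state x₀ w t ω - holdEstimator H S x₀ w N t₁ r t ω‖ₑ ^ 2
      ≤ ENNReal.ofReal (∑ j, (∑ i, H j i ^ 2) * ∑ i, (2 * (e i ω ^ 2 + Y j i ω ^ 2))) := by
    filter_upwards [hdec] with ω hω
    rw [← ofReal_norm, ← ENNReal.ofReal_pow (norm_nonneg _), EuclideanSpace.real_norm_sq_eq]
    refine ENNReal.ofReal_le_ofReal (Finset.sum_le_sum fun j _ => ?_)
    rw [hω j]
    refine (Finset.sum_mul_sq_le_sq_mul_sq _ _ _).trans ?_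
    gcongr with i
    nlinarith [sq_nonneg (e i ω + Y j i ω)]
  have hint : ∀ j i, Integrable (fun ω => 2 * (e i ω ^ 2 + Y j i ω ^ 2)) μ := fun j i =>
    ((heL i).integrable_sq.add (hYL j i).integrable_sq).const_mul 2
  have hint' : ∀ j, Integrable (fun ω => (∑ i, H j i ^ 2) * ∑ i, (2 * (e i ω ^ 2 + Y j i ω ^ 2))) μ :=
    fun j => (integrable_finsetSum _ fun i _ => hint j i).const_mul _
  refine (lintegral_mono_ae hpt).trans ?_
  rw [← ofReal_integral_eq_lintegral_ofReal (integrable_finsetSum _ fun j _ => hint' j)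
    (ae_of_all _ fun ω => Finset.sum_nonneg fun j _ => by positivity)]
  refine ENNReal.ofReal_le_ofReal ?_
  rw [integral_finsetSum _ fun j _ => hint' j, mul_assoc, mul_left_comm, Finset.sum_mul]
  refine Finset.sum_le_sum fun j _ => ?_
  rw [integral_const_mul]
  refine mul_le_mul_of_nonneg_left ?_ (by positivity)
  rw [integral_finsetSum _ fun i _ => hint j i, Finset.mul_sum]
  refine Finset.sum_le_sum fun i _ => ?_
  rw [integral_const_mul, integral_add (heL i).integrable_sq (hYL j i).integrable_sq, heI]
  have := hYI j i
  linarith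

end upper

/-! ### The schedule with square-root periods and the upper bound. -/

section upper

theorem exists_mod_eq {P v t : ℕ} (hv : v < P) (hP : P ≤ t) : ∃ s ≤ t, t < s + P ∧ s % P = v := by
  have h1 := Nat.div_add_mod (t - v) P
  have h2 := Nat.mod_lt (t - v) (by omega : 0 < P)
  refine ⟨v + P * ((t - v) / P), by omega, by omega, ?_⟩
  rw [Nat.add_mul_mod_self_left, Nat.mod_eq_of_lt hv]

theorem sum_ite_mod_eq_le {P : ℕ} (hP : 0 < P) (v T : ℕ) :
    ∑ t ∈ Finset.Icc 1 T, (if t % P = v then (1 : ℝ) else 0) ≤ T / P + 1 := by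
  have hP' : (0 : ℝ) < P := by exact_mod_cast hP
  rw [Finset.sum_boole]
  have h1 : ((Finset.Icc 1 T).filter (fun t => t % P = v)).card ≤ T / P + 1 := by
    rw [← Finset.card_range (T / P + 1)]
    -- Within one residue class the quotient by `P` determines `t`.
    refine Finset.card_le_card_of_injOn (fun t => t / P) ?_ ?_
    · intro t ht
      have := (Finset.mem_Icc.1 (Finset.mem_filter.1 ht).1).2
      simpa [Nat.lt_succ_iff] using Nat.div_le_div_right this
    · intro s hs t ht hst
      have h1 := (Finset.mem_filter.1 hs).2
      have h2 := (Finset.mem_filter.1 ht).2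
      rw [← Nat.div_add_mod s P, ← Nat.div_add_mod t P, h1, h2]
      simp only at hst
      rw [hst]
  calc (((Finset.Icc 1 T).filter (fun t => t % P = v)).card : ℝ) ≤ ((T / P + 1 : ℕ) : ℝ) := by
        exact_mod_cast h1
    _ ≤ T / P + 1 := by
        push_cast
        gcongr
        exact Nat.cast_div_le

/-- The schedule which first spends `N` blocks of `L + M` slots on reading the selected sources and
then all sources, and afterwards reads `S i` in the slots congruent to `i` modulo `L * K i` and
`S i₀` in the remaining ones. -/
def blockSchedule {M L : ℕ} (hL : 0 < L) (S : Fin L ↪ Fin M) (i₀ : Fin L) (K : Fin L → ℕ) (N : ℕ)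
    (t : ℕ) : Fin M :=
  if t < N * (L + M) then
    if h : t % (L + M) < L then S ⟨t % (L + M), h⟩
    else ⟨t % (L + M) - L, by have := Nat.mod_lt t (by omega : 0 < L + M); omega⟩
  else if t % (L * K ⟨t % L, Nat.mod_lt t hL⟩) = t % L then S ⟨t % L, Nat.mod_lt t hL⟩ else S i₀

section blockSchedule

variable {M L : ℕ} {hL : 0 < L} {S : Fin L ↪ Fin M} {i₀ : Fin L} {K : Fin L → ℕ} {N : ℕ}

theorem blockSchedule_selected {n : ℕ} (hn : n < N) (i : Fin L) :
    blockSchedule hL S i₀ K N (n * (L + M) + i) = S i := by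
  have h1 : (n + 1) * (L + M) ≤ N * (L + M) := Nat.mul_le_mul_right _ hn
  rw [add_mul] at h1
  have h2 : (n * (L + M) + i) % (L + M) = i := by
    rw [Nat.mul_add_mod', Nat.mod_eq_of_lt (by omega)]
  have h3 : n * (L + M) + i < N * (L + M) := by omega
  simp [blockSchedule, h2, h3]

theorem blockSchedule_all {n : ℕ} (hn : n < N) (j : Fin M) :
    blockSchedule hL S i₀ K N (n * (L + M) + (L + j)) = j := by
  have h1 : (n + 1) * (L + M) ≤ N * (L + M) := Nat.mul_le_mul_right _ hn
  rw [add_mul] at h1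
  have h2 : (n * (L + M) + (L + j)) % (L + M) = L + j := by
    rw [Nat.mul_add_mod', Nat.mod_eq_of_lt (by omega)]
  have h3 : n * (L + M) + (L + j) < N * (L + M) := by omega
  simp [blockSchedule, h2, h3]

/-- As `L` divides `L * K i`, the slots claimed by `i` are congruent to `i` modulo `L`, and distinct
sources never collide. -/
theorem blockSchedule_of_mod_eq {t : ℕ} (ht : N * (L + M) ≤ t) {i : Fin L}
    (h : t % (L * K i) = i) : blockSchedule hL S i₀ K N t = S i := by
  have h1 : t % L = i := by
    rw [← Nat.mod_mul_right_mod t L (K i), h, Nat.mod_eq_of_lt i.2]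
  have h2 : (⟨t % L, Nat.mod_lt t hL⟩ : Fin L) = i := Fin.ext h1
  simp only [blockSchedule, Nat.not_lt.2 ht, if_false, h2]
  simp [h, h1]

theorem blockSchedule_of_mod_eq_default {t : ℕ} (ht : N * (L + M) ≤ t) (h : t % L = i₀) :
    blockSchedule hL S i₀ K N t = S i₀ := by
  have h2 : (⟨t % L, Nat.mod_lt t hL⟩ : Fin L) = i₀ := Fin.ext h
  simp only [blockSchedule, Nat.not_lt.2 ht, if_false, h2, ite_self]

/-- An upper bound for the time since the last read of `S i` under `blockSchedule`. -/
def ageBound (i₀ : Fin L) (K : Fin L → ℕ) (i : Fin L) (t : ℕ) : ℝ :=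
  if i = i₀ then L * ∑ k ∈ Finset.univ.erase i₀, (if t % (L * K k) = k then (1 : ℝ) else 0)
  else L * K i

theorem exists_read (hK : ∀ i, 0 < K i) {t : ℕ} (ht : N * (L + M) + ∑ i, L * K i ≤ t) (i : Fin L) :
    ∃ s ≤ t, blockSchedule hL S i₀ K N s = S i ∧ ((t - s : ℕ) : ℝ) ≤ ageBound i₀ K i t := by
  have hsum : L * K i ≤ ∑ i, L * K i :=
    Finset.single_le_sum (f := fun i => L * K i) (fun _ _ => Nat.zero_le _) (Finset.mem_univ i)
  have hLK : L ≤ L * K i := Nat.le_mul_of_pos_right _ (hK i)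
  by_cases hi : i = i₀
  · subst hi
    by_cases hd : blockSchedule hL S i K N t = S i
    · refine ⟨t, le_rfl, hd, ?_⟩
      simp only [ageBound, if_true, Nat.sub_self, Nat.cast_zero]
      exact mul_nonneg (Nat.cast_nonneg _)
        (Finset.sum_nonneg fun k _ => by split_ifs <;> norm_num)
    · obtain ⟨s, hst, hts, hs⟩ := exists_mod_eq i.2 (hLK.trans (by omega : L * K i ≤ t))
      refine ⟨s, hst, blockSchedule_of_mod_eq_default (by omega) hs, ?_⟩
      have h1 : ((t - s : ℕ) : ℝ) ≤ L := by exact_mod_cast (by omega)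
      simp only [ageBound, if_true]
      refine h1.trans (le_mul_of_one_le_right (Nat.cast_nonneg _) ?_)
      -- The slot was lent to some `k ≠ i`, whose indicator in `ageBound` pays for an age of at most
      -- `L`.
      set k : Fin L := ⟨t % L, Nat.mod_lt t hL⟩ with hk
      have hki : k ≠ i := fun h => hd
        (blockSchedule_of_mod_eq_default (by omega) (by rw [← h]))
      have hkt : t % (L * K k) = k := by
        by_contra h
        refine hd ?_
        have h' : ¬ t % (L * K k) = t % L := h
        simp only [blockSchedule, Nat.not_lt.2 (by omega : N * (L + M) ≤ t), if_false, ← hk, h']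
      calc (1 : ℝ) = if t % (L * K k) = k then (1 : ℝ) else 0 := by rw [if_pos hkt]
        _ ≤ _ := Finset.single_le_sum
            (f := fun k : Fin L => if t % (L * K k) = k then (1 : ℝ) else 0)
            (fun _ _ => by split_ifs <;> norm_num)
            (Finset.mem_erase.2 ⟨hki, Finset.mem_univ k⟩)
  · obtain ⟨s, hst, hts, hs⟩ := exists_mod_eq (i.2.trans_le hLK) (by omega : L * K i ≤ t)
    refine ⟨s, hst, blockSchedule_of_mod_eq (by omega) hs, ?_⟩
    simp only [ageBound, hi, if_false]
    exact_mod_cast (by omega : t - s ≤ L * K i)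

theorem ageBound_nonneg (i : Fin L) (t : ℕ) : 0 ≤ ageBound i₀ K i t := by
  unfold ageBound
  split_ifs
  · exact mul_nonneg (Nat.cast_nonneg _) (Finset.sum_nonneg fun k _ => by split_ifs <;> norm_num)
  · positivity

theorem sum_ageBound_le (hL : 0 < L) (hK : ∀ i, 0 < K i) (i : Fin L) (T : ℕ) :
    ∑ t ∈ Finset.Icc 1 T, ageBound i₀ K i t
      ≤ L * L + (if i = i₀ then ∑ k ∈ Finset.univ.erase i₀, (K k : ℝ)⁻¹ else L * K i) * T := by
  have hL' : (0 : ℝ) < L := by exact_mod_cast hL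
  by_cases hi : i = i₀
  · simp only [ageBound, hi, if_true]
    rw [← Finset.mul_sum, Finset.sum_comm]
    have h1 : ∑ k ∈ Finset.univ.erase i₀, ∑ t ∈ Finset.Icc 1 T,
        (if t % (L * K k) = k then (1 : ℝ) else 0)
        ≤ ∑ k ∈ Finset.univ.erase i₀, ((T : ℝ) / (L * K k : ℕ) + 1) :=
      Finset.sum_le_sum fun k _ => sum_ite_mod_eq_le (Nat.mul_pos hL (hK k)) _ _
    have h2 : ((Finset.univ.erase i₀).card : ℝ) ≤ L := by
      have : (Finset.univ.erase i₀).card ≤ L := by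
        simp
      exact_mod_cast this
    calc (L : ℝ) * _ ≤ L * ∑ k ∈ Finset.univ.erase i₀, ((T : ℝ) / (L * K k : ℕ) + 1) :=
          mul_le_mul_of_nonneg_left h1 hL'.le
      _ = (∑ k ∈ Finset.univ.erase i₀, (K k : ℝ)⁻¹) * T + L * (Finset.univ.erase i₀).card := by
          rw [Finset.sum_add_distrib, mul_add, Finset.mul_sum, Finset.sum_mul]
          congr 1
          · refine Finset.sum_congr rfl fun k _ => ?_
            have : (K k : ℝ) ≠ 0 := by exact_mod_cast (hK k).ne'
            push_cast
            field_simp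
          · simp
      _ ≤ _ := by nlinarith
  · simp only [ageBound, hi, if_false, Finset.sum_const, Nat.card_Icc, nsmul_eq_mul]
    push_cast
    nlinarith

end blockSchedule

/-- Square root periods balance the reads of the rarely and of the mostly read sources. -/
theorem sum_mul_rate_le {L : ℕ} (hL : 0 < L) {q : Fin L → ℝ} (hq : ∀ i, 0 < q i) {i₀ : Fin L}
    (hmax : ∀ i, q i ≤ q i₀) :
    ∑ i, q i * (if i = i₀ then ∑ k ∈ Finset.univ.erase i₀, (⌈√(q i₀ / q k)⌉₊ : ℝ)⁻¹
        else L * ⌈√(q i₀ / q i)⌉₊)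
      ≤ (2 * L + 1) * ((∑ i, √(q i)) ^ 2 - ∑ i, q i) := by
  have hL' : (0 : ℝ) < L := by exact_mod_cast hL
  have hs : ∀ i, 0 < √(q i) := fun i => Real.sqrt_pos.2 (hq i)
  have hss : ∀ i, √(q i) * √(q i) = q i := fun i => Real.mul_self_sqrt (hq i).le
  have hdiv : ∀ i, √(q i₀ / q i) = √(q i₀) / √(q i) := fun i => Real.sqrt_div (hq i₀).le _
  have hone : ∀ i, 1 ≤ √(q i₀) / √(q i) := fun i =>
    (one_le_div (hs i)).2 (Real.sqrt_le_sqrt (hmax i))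
  set G' := ∑ i ∈ Finset.univ.erase i₀, √(q i₀) * √(q i) with hG'
  have hG : G' ≤ (∑ i, √(q i)) ^ 2 - ∑ i, q i := by
    have h1 : (∑ i, √(q i)) ^ 2 - ∑ i, q i = ∑ i, √(q i) * ∑ k ∈ Finset.univ.erase i, √(q k) := by
      rw [sq, Finset.sum_mul, ← Finset.sum_sub_distrib]
      refine Finset.sum_congr rfl fun i _ => ?_
      rw [← Finset.add_sum_erase _ _ (Finset.mem_univ i), mul_add, hss]
      ring
    rw [h1, hG', ← Finset.mul_sum]
    exact Finset.single_le_sum (f := fun i => √(q i) * ∑ k ∈ Finset.univ.erase i, √(q k))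
      (fun i _ => mul_nonneg (hs i).le (Finset.sum_nonneg fun k _ => (hs k).le))
      (Finset.mem_univ i₀)
  rw [← Finset.add_sum_erase _ _ (Finset.mem_univ i₀), if_pos rfl, Finset.mul_sum]
  have h1 : ∑ k ∈ Finset.univ.erase i₀, q i₀ * (⌈√(q i₀ / q k)⌉₊ : ℝ)⁻¹ ≤ G' := by
    refine Finset.sum_le_sum fun k _ => ?_
    rw [hdiv]
    have h2 : (⌈√(q i₀) / √(q k)⌉₊ : ℝ)⁻¹ ≤ (√(q i₀) / √(q k))⁻¹ :=
      inv_anti₀ (div_pos (hs _) (hs _)) (Nat.le_ceil _)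
    calc q i₀ * (⌈√(q i₀) / √(q k)⌉₊ : ℝ)⁻¹ ≤ q i₀ * (√(q i₀) / √(q k))⁻¹ :=
          mul_le_mul_of_nonneg_left h2 (hq _).le
      _ = √(q i₀) * √(q k) := by
          nth_rewrite 1 [← hss i₀]
          have := (hs i₀).ne'
          field_simp
  have h2 : ∑ i ∈ Finset.univ.erase i₀, q i * (if i = i₀ then
      ∑ k ∈ Finset.univ.erase i₀, (⌈√(q i₀ / q k)⌉₊ : ℝ)⁻¹ else L * ⌈√(q i₀ / q i)⌉₊)
      ≤ 2 * L * G' := by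
    rw [hG', Finset.mul_sum]
    refine Finset.sum_le_sum fun i hi => ?_
    rw [if_neg (Finset.ne_of_mem_erase hi), hdiv]
    -- Rounding up at most doubles a number that is at least one, as `q i₀` is maximal.
    have h3 : (⌈√(q i₀) / √(q i)⌉₊ : ℝ) ≤ 2 * (√(q i₀) / √(q i)) := by
      have := (Nat.ceil_lt_add_one (div_pos (hs i₀) (hs i)).le).le
      linarith [hone i]
    calc q i * (L * ⌈√(q i₀) / √(q i)⌉₊) ≤ q i * (L * (2 * (√(q i₀) / √(q i)))) :=
          mul_le_mul_of_nonneg_left (mul_le_mul_of_nonneg_left h3 hL'.le) (hq _).le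
      _ = 2 * L * (√(q i₀) * √(q i)) := by
          nth_rewrite 1 [← hss i]
          have := (hs i).ne'
          field_simp
  calc _ ≤ G' + 2 * L * G' := add_le_add h1 h2
    _ = (2 * L + 1) * G' := by ring
    _ ≤ _ := mul_le_mul_of_nonneg_left hG (by positivity)

variable {Ω R : Type*} [MeasurableSpace Ω] [MeasurableSpace R] {M : ℕ} {μ : Measure Ω}
  {m₀ : EuclideanSpace ℝ (Fin M)} {P₀ Q : Matrix (Fin M) (Fin M) ℝ} {U : Ω → R}
  {x₀ : Ω → EuclideanSpace ℝ (Fin M)} {w : ℕ → Ω → EuclideanSpace ℝ (Fin M)}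

theorem IsGaussianWalk.optimalError_le_add [IsProbabilityMeasure μ]
    (hw : IsGaussianWalk μ m₀ P₀ Q U x₀ w)
    {L : ℕ} (hL : 1 ≤ L) (hQ : Q.PosSemidef) (hQL : Q.rank = L) {S : Fin L ↪ Fin M}
    (hS : (Q.submatrix S S).rank = L) {N : ℕ} (hN : 0 < N) :
    optimalError μ U x₀ w ≤ ENNReal.ofReal
      (2 * (∑ j, ∑ i, coefficients Q S j i ^ 2) * (2 * L + 1)
          * ((∑ i, √(Q (S i) (S i))) ^ 2 - ∑ i, Q (S i) (S i))
        + 2 * (∑ j, ∑ i, coefficients Q S j i ^ 2) * (∑ i, Q (S i) (S i)) * (L + M : ℕ) / N) := by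
  have hpd := posDef_of_rank_eq (hQ.submatrix S) hS
  have hq : ∀ i, 0 < Q (S i) (S i) := fun i => hpd.diag_pos (i := i)
  have : Nonempty (Fin L) := ⟨⟨0, hL⟩⟩
  obtain ⟨i₀, hmax⟩ := Finite.exists_max fun i => Q (S i) (S i)
  set h : ℝ := ∑ j, ∑ i, coefficients Q S j i ^ 2
  have hh : 0 ≤ h := Finset.sum_nonneg fun j _ => Finset.sum_nonneg fun i _ => sq_nonneg _
  let K : Fin L → ℕ := fun i => ⌈√(Q (S i₀) (S i₀) / Q (S i) (S i))⌉₊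
  have hK : ∀ i, 0 < K i := fun i => Nat.ceil_pos.2 (Real.sqrt_pos.2 (div_pos (hq i₀) (hq i)))
  let d := blockSchedule (M := M) hL S i₀ K N
  -- One full period of every source after training, so that the latest read used lies past the
  -- training phase.
  let t₁ := N * (L + M) + ∑ i, L * K i
  have hread : ∀ t i, ∃ s, t₁ ≤ t →
      s ≤ t ∧ d s = S i ∧ ((t - s : ℕ) : ℝ) ≤ ageBound i₀ K i t := by
    intro t i
    by_cases ht : t₁ ≤ t
    · obtain ⟨s, h1, h2⟩ := exists_read (hL := hL) (S := S) (i₀ := i₀) hK ht i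
      exact ⟨s, fun _ => ⟨h1, h2⟩⟩
    · exact ⟨0, fun h => absurd h ht⟩
  choose r hr using hread
  have hest : IsEstimator U x₀ w (fun s _ => d s)
      (holdEstimator (coefficients Q S) S x₀ w N t₁ r) :=
    isEstimator_holdEstimator _ S (fun n hn i => blockSchedule_selected hn i)
      (fun n hn j => blockSchedule_all hn j) (Nat.le_add_right _ _)
      (fun t ht i => ⟨(hr t i ht).1, (hr t i ht).2.1⟩)
  have hsched : IsObliviousSchedule U x₀ w (fun s _ => d s) := fun s => measurable_const
  refine (iInf₂_le_of_le _ hsched (iInf₂_le_of_le _ hest le_rfl)).trans ?_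
  set a : ℕ → ENNReal := fun t =>
    ∫⁻ ω, ‖state x₀ w t ω - holdEstimator (coefficients Q S) S x₀ w N t₁ r t ω‖ₑ ^ 2 ∂μ
  have hlate : ∀ t, t₁ ≤ t → a t ≤ ENNReal.ofReal (2 * h * ∑ i, Q (S i) (S i)
      * ((t - r t i : ℕ) + ((L + M : ℕ) : ℝ) / N)) := fun t ht =>
    hw.lintegral_holdEstimator_le hQ hQL hS hN ht fun i => (hr t i ht).1
  let α : Fin L → ℝ := fun i =>
    if i = i₀ then ∑ k ∈ Finset.univ.erase i₀, (K k : ℝ)⁻¹ else L * K i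
  refine (limsup_average_le (e := fun t => 2 * h * ∑ i, Q (S i) (S i)
      * (ageBound i₀ K i t + ((L + M : ℕ) : ℝ) / N))
    (E₀ := 2 * h * ∑ i, Q (S i) (S i) * (L * L))
    (E := 2 * h * ∑ i, Q (S i) (S i) * (α i + ((L + M : ℕ) : ℝ) / N)) t₁ ?_ ?_ ?_ ?_).trans ?_
  · intro t
    by_cases ht : t₁ ≤ t
    · exact ((hlate t ht).trans_lt ENNReal.ofReal_lt_top).ne
    · simpa [a, holdEstimator, ht] using hw.lintegral_state_ne_top t
  · intro t
    refine mul_nonneg (by positivity) (Finset.sum_nonneg fun i _ => mul_nonneg (hq i).le ?_)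
    have := ageBound_nonneg (i₀ := i₀) (K := K) i t
    positivity
  · intro t ht
    refine (hlate t ht).trans (ENNReal.ofReal_le_ofReal ?_)
    refine mul_le_mul_of_nonneg_left (Finset.sum_le_sum fun i _ => ?_) (by positivity)
    refine mul_le_mul_of_nonneg_left ?_ (hq i).le
    have := (hr t i ht).2.2
    linarith
  · intro T
    rw [← Finset.mul_sum, Finset.sum_comm, mul_assoc (2 * h), ← mul_add, Finset.sum_mul,
      ← Finset.sum_add_distrib]
    refine mul_le_mul_of_nonneg_left (Finset.sum_le_sum fun i _ => ?_) (by positivity)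
    rw [← Finset.mul_sum, mul_assoc, ← mul_add]
    refine mul_le_mul_of_nonneg_left ?_ (hq i).le
    rw [Finset.sum_add_distrib, Finset.sum_const, Nat.card_Icc, nsmul_eq_mul]
    have := sum_ageBound_le (i₀ := i₀) hL hK i T
    simp only [α, Nat.add_sub_cancel]
    linarith
  · refine ENNReal.ofReal_le_ofReal ?_
    have h1 := sum_mul_rate_le hL hq hmax
    have h2 : ∑ i, Q (S i) (S i) * (α i + ((L + M : ℕ) : ℝ) / N)
        = ∑ i, Q (S i) (S i) * α i + (∑ i, Q (S i) (S i)) * (((L + M : ℕ) : ℝ) / N) := by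
      rw [Finset.sum_mul, ← Finset.sum_add_distrib]
      simp_rw [mul_add]
    rw [h2, mul_add]
    have h3 := mul_le_mul_of_nonneg_left h1 (by positivity : 0 ≤ 2 * h)
    refine add_le_add ?_ (le_of_eq (by ring))
    rw [mul_assoc (2 * h)]
    exact h3

/-- An infimum need not be attained: training costs `O(1/N)`, and `N` is sent to infinity. For `L =
1` the bound is zero, so no residue could be absorbed into the constant. -/
theorem IsGaussianWalk.optimalError_le [IsProbabilityMeasure μ]
    (hw : IsGaussianWalk μ m₀ P₀ Q U x₀ w)
    {L : ℕ} (hL : 1 ≤ L) (hQ : Q.PosSemidef) (hQL : Q.rank = L) {S : Fin L ↪ Fin M}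
    (hS : (Q.submatrix S S).rank = L) :
    optimalError μ U x₀ w ≤ ENNReal.ofReal
      (2 * (∑ j, ∑ i, coefficients Q S j i ^ 2) * (2 * L + 1)
          * ((∑ i, √(Q (S i) (S i))) ^ 2 - ∑ i, Q (S i) (S i))) := by
  set a : ℝ := 2 * (∑ j, ∑ i, coefficients Q S j i ^ 2) * (2 * L + 1)
    * ((∑ i, √(Q (S i) (S i))) ^ 2 - ∑ i, Q (S i) (S i))
  set b : ℝ := 2 * (∑ j, ∑ i, coefficients Q S j i ^ 2) * (∑ i, Q (S i) (S i)) * (L + M : ℕ)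
  have hlim : Tendsto (fun N : ℕ => ENNReal.ofReal (a + b / N)) atTop (nhds (ENNReal.ofReal a)) := by
    refine ENNReal.tendsto_ofReal ?_
    simpa using (tendsto_const_div_atTop_nhds_zero_nat b).const_add a
  exact ge_of_tendsto hlim
    ((eventually_gt_atTop 0).mono fun N hN => hw.optimalError_le_add hL hQ hQL hS hN)

end upper

end Monitoring

end

theorem theorem4 (M L : ℕ) (hL : 1 ≤ L) (hLM : L < M) :
    ∃ c : Matrix (Fin M) (Fin L) ℝ → ℝ, (∀ H, 0 < c H) ∧
      ∀ (Q P₀ : Matrix (Fin M) (Fin M) ℝ) (hQ : Q.PosSemidef) (_ : P₀.PosSemidef)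
        (_ : Q.rank = L) (S : Fin L ↪ Fin M) (_ : (Q.submatrix S S).rank = L)
        {Ω R : Type*} [MeasurableSpace Ω] [MeasurableSpace R]
        (μ : Measure Ω) [IsProbabilityMeasure μ]
        (m₀ : EuclideanSpace ℝ (Fin M)) (U : Ω → R) (x₀ : Ω → EuclideanSpace ℝ (Fin M))
        (w : ℕ → Ω → EuclideanSpace ℝ (Fin M))
        (_ : Monitoring.IsGaussianWalk μ m₀ P₀ Q U x₀ w),
        (((L : ℝ) * (L + 1) / 2
              * Monitoring.eigenvalue (hQ.submatrix S).isHermitian L ⟨hL, le_refl L⟩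
            - Q.trace : ℝ) : EReal)
          ≤ (Monitoring.optimalError μ U x₀ w : EReal) ∧
        (Monitoring.optimalError μ U x₀ w : EReal)
          ≤ ((c (Monitoring.coefficients Q S)
              * ((∑ i : Fin L, √(Q (S i) (S i))) ^ 2 - ∑ i : Fin L, Q (S i) (S i)) : ℝ) : EReal) := by
  -- The added `1` keeps the constant positive also at `H = 0`.
  refine ⟨fun H => 2 * (∑ j, ∑ i, H j i ^ 2 + 1) * (2 * L + 1), fun H => ?_, ?_⟩
  · have : 0 ≤ ∑ j, ∑ i, H j i ^ 2 :=
      Finset.sum_nonneg fun j _ => Finset.sum_nonneg fun i _ => sq_nonneg _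
    positivity
  intro Q P₀ hQ _ hQL S hS Ω R _ _ μ _ m₀ U x₀ w hw
  have hG : 0 ≤ (∑ i : Fin L, √(Q (S i) (S i))) ^ 2 - ∑ i : Fin L, Q (S i) (S i) := by
    rw [sub_nonneg]
    calc ∑ i : Fin L, Q (S i) (S i) = ∑ i : Fin L, √(Q (S i) (S i)) ^ 2 :=
          Finset.sum_congr rfl fun i _ => (Real.sq_sqrt hQ.diag_nonneg).symm
      _ ≤ _ := Finset.sum_sq_le_sq_sum_of_nonneg fun i _ => Real.sqrt_nonneg _
  constructor
  · refine le_trans ?_ (EReal.coe_ennreal_le_coe_ennreal_iff.2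
      (hw.le_optimalError hL hLM hQ hQL hS))
    rw [EReal.coe_ennreal_ofReal]
    -- The real lower bound may be negative; `ENNReal.ofReal` truncates it at zero, which only
    -- raises it.
    exact_mod_cast le_max_left _ _
  · have h0 : 0 ≤ ∑ j, ∑ i, Monitoring.coefficients Q S j i ^ 2 :=
      Finset.sum_nonneg fun j _ => Finset.sum_nonneg fun i _ => sq_nonneg _
    have h1 : Monitoring.optimalError μ U x₀ w ≤ ENNReal.ofReal
        (2 * (∑ j, ∑ i, Monitoring.coefficients Q S j i ^ 2 + 1) * (2 * L + 1)
          * ((∑ i, √(Q (S i) (S i))) ^ 2 - ∑ i, Q (S i) (S i))) := by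
      refine (hw.optimalError_le hL hQ hQL hS).trans (ENNReal.ofReal_le_ofReal ?_)
      refine mul_le_mul_of_nonneg_right ?_ hG
      gcongr
      linarith
    refine (EReal.coe_ennreal_le_coe_ennreal_iff.2 h1).trans ?_
    rw [EReal.coe_ennreal_ofReal, max_eq_left (by positivity)]
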